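/- Let $k$ be an algebraically closed field of characteristic $0$ and let $H$ be a finite-dimensional Hopf algebra over $k$. Write $H_0\subseteq H_1\subseteq\cdots$ for the coradical filtration: $H_0$ is the sum of the simple subcoalgebras of $H$, and $H_{m+1}=\Delta^{-1}(H_0\otimes H+H\otimes H_m)$. Suppose that: 1. $H$ is not cosemisimple, i.e. $H_0\neq H$; 2. $H$ has no nontrivial skew-primitives: whenever $\Delta(x)=x\otimes g+h\otimes x$ with $g,h\in H$ grouplike, $x$ lies in the linear span of the grouplike elements of $H$; 3. there is a coalgebra isomorphism $H_0\cong k[G]\oplus\mathcal M^c(n_1,k)\oplus\cdots\oplus\mathcal M^c(n_t,k)$, where $G$ is a group, $t\ge 1$ and $2\le n_1\le n_2\le\cdots\le n_t$. Here the group algebra $k[G]$ has the coalgebra structure in which every $g\in G$ is grouplike, and $\mathcal M^c(n,k)$ is the matrix coalgebra with basis $(e_{ij})_{1\le i,j\le n}$, $\Delta(e_{ij})=\sum_{r=1}^n e_{ir}\otimes e_{rj}$ and $\varepsilon(e_{ij})=\delta_{ij}$. For a coalgebra projection $\pi\colon H\to H_0$ (a coalgebra map which is the identity on $H_0$), put $P_1=P_1(\pi)=\{x\in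 H:\Delta(x)=(\pi\otimes\mathrm{id})\Delta(x)+(\mathrm{id}\otimes\pi)\Delta(x)\}$. Then, for every such $\pi$, $$\dim H>\dim H_1=\dim H_0+\dim P_1\ \ge\ (1+2n_1)\,|G|+\sum_{i=1}^t n_i^2 .$$ The inequalities $\dim H>\dim H_1\ge(1+2n_1)|G|+\sum_{i=1}^t n_i^2$ do not depend on the choice of $\pi$, and hold without reference to any $\pi$. -/

import Mathlib

open scoped TensorProduct

/-- The matrix coalgebra `M^c(n, k)`: the space of `n × n` matrices over `k`, with the coalgebra
structure given on the matrix units `e i j` by `Δ(e i j) = ∑ r, e i r ⊗ e r j` and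
`ε(e i j) = δ_{ij}`. -/
def MatrixCoalgebra (n : ℕ) (k : Type*) : Type _ := Matrix (Fin n) (Fin n) k

namespace MatrixCoalgebra

section

variable (n : ℕ) (k : Type*) [CommRing k]

noncomputable instance : AddCommGroup (MatrixCoalgebra n k) :=
  inferInstanceAs (AddCommGroup (Matrix (Fin n) (Fin n) k))

noncomputable instance : Module k (MatrixCoalgebra n k) :=
  inferInstanceAs (Module k (Matrix (Fin n) (Fin n) k))

/-- The basis of matrix units; `basis n k (i, j)` is `e i j`. -/
noncomputable def basis : Module.Basis (Fin n × Fin n) k (MatrixCoalgebra n k) :=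
  Matrix.stdBasis k (Fin n) (Fin n)

noncomputable instance : CoalgebraStruct k (MatrixCoalgebra n k) where
  comul := (basis n k).constr k fun p =>
    ∑ r : Fin n, basis n k (p.1, r) ⊗ₜ[k] basis n k (r, p.2)
  counit := (basis n k).constr k fun p => if p.1 = p.2 then 1 else 0

theorem comul_basis (i j : Fin n) :
    CoalgebraStruct.comul (R := k) (basis n k (i, j)) =
      ∑ r : Fin n, basis n k (i, r) ⊗ₜ[k] basis n k (r, j) :=
  (basis n k).constr_basis k _ (i, j)

theorem counit_basis (i j : Fin n) :
    CoalgebraStruct.counit (R := k) (basis n k (i, j)) = if i = j then 1 else 0 :=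
  (basis n k).constr_basis k _ (i, j)

noncomputable instance : Coalgebra k (MatrixCoalgebra n k) where
  coassoc := by
    refine (basis n k).ext fun ⟨i, j⟩ => ?_
    simp only [LinearMap.comp_apply, comul_basis, map_sum, LinearMap.rTensor_tmul,
      LinearMap.lTensor_tmul, TensorProduct.sum_tmul, TensorProduct.tmul_sum,
      LinearEquiv.coe_coe, TensorProduct.assoc_tmul]
    exact Finset.sum_comm
  rTensor_counit_comp_comul := by
    refine (basis n k).ext fun ⟨i, j⟩ => ?_
    simp [comul_basis, counit_basis, TensorProduct.ite_tmul]
  lTensor_counit_comp_comul := by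
    refine (basis n k).ext fun ⟨i, j⟩ => ?_
    simp [comul_basis, counit_basis, TensorProduct.tmul_ite]

end

end MatrixCoalgebra

section Coalgebras

variable (k : Type*) {C : Type*} [Field k] [AddCommGroup C] [Module k C] [Coalgebra k C]

/-- A subspace `D` of a coalgebra is a subcoalgebra if `Δ(D) ⊆ D ⊗ D`. -/
def IsSubcoalgebra (D : Submodule k C) : Prop :=
  ∀ x ∈ D, Coalgebra.comul (R := k) x ∈
    LinearMap.range (TensorProduct.map D.subtype D.subtype)

/-- A simple subcoalgebra: a nonzero subcoalgebra with no subcoalgebras other than `0` and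
itself. -/
structure IsSimpleSubcoalgebra (D : Submodule k C) : Prop where
  isSubcoalgebra : IsSubcoalgebra k D
  ne_bot : D ≠ ⊥
  eq_bot_or_eq : ∀ E : Submodule k C, IsSubcoalgebra k E → E ≤ D → E = ⊥ ∨ E = D

variable (C) in
/-- The coradical `C₀`: the sum of all simple subcoalgebras. -/
def coradical : Submodule k C :=
  sSup {D : Submodule k C | IsSimpleSubcoalgebra k D}

variable (C) in
/-- A coalgebra is cosemisimple if it is the sum of its simple subcoalgebras. -/
def IsCosemisimple : Prop := coradical k C = ⊤

/-- The wedge `X ∧ Y = Δ⁻¹(X ⊗ C + C ⊗ Y)` of two subspaces. -/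
def wedge (X Y : Submodule k C) : Submodule k C :=
  Submodule.comap (Coalgebra.comul (R := k) (A := C))
    (LinearMap.range (X.subtype.rTensor C) ⊔ LinearMap.range (Y.subtype.lTensor C))

variable (C) in
/-- The coradical filtration: `C₀` is the coradical and `Cₙ₊₁ = C₀ ∧ Cₙ`. -/
def coradicalFiltration : ℕ → Submodule k C
  | 0 => coradical k C
  | m + 1 => wedge k (coradical k C) (coradicalFiltration m)

variable (C) in
/-- `k[G(C)]`: the span of the grouplike elements. -/
def groupLikeSpan : Submodule k C :=
  Submodule.span k {g : C | IsGroupLikeElem k g}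

/-- `x` is skew-primitive if `Δ(x) = x ⊗ g + h ⊗ x` for some grouplike elements `g`, `h`. -/
def IsSkewPrimitive (x : C) : Prop :=
  ∃ g h : C, IsGroupLikeElem k g ∧ IsGroupLikeElem k h ∧
    Coalgebra.comul (R := k) x = x ⊗ₜ[k] g + h ⊗ₜ[k] x

variable (C) in
/-- There are no nontrivial skew-primitives: each one lies in the span of the grouplikes. -/
def NoNontrivialSkewPrimitives : Prop :=
  ∀ x : C, IsSkewPrimitive k x → x ∈ groupLikeSpan k C

variable {k}

/-- A coalgebra projection of `C` onto its coradical, regarded as a coalgebra map `C → C` with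
image `C₀` which is the identity on `C₀`. -/
structure IsCoradicalProjection (π : C →ₗc[k] C) : Prop where
  range_eq : LinearMap.range (π : C →ₗ[k] C) = coradical k C
  apply_of_mem : ∀ x ∈ coradical k C, π x = x

/-- The coaction `ρ_L = (π ⊗ id) Δ`. -/
noncomputable def rhoL (π : C →ₗc[k] C) : C →ₗ[k] C ⊗[k] C :=
  (π : C →ₗ[k] C).rTensor C ∘ₗ Coalgebra.comul

/-- The coaction `ρ_R = (id ⊗ π) Δ`. -/
noncomputable def rhoR (π : C →ₗc[k] C) : C →ₗ[k] C ⊗[k] C :=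
  (π : C →ₗ[k] C).lTensor C ∘ₗ Coalgebra.comul

/-- The subspace `P₁ = {x | Δ(x) = ρ_L(x) + ρ_R(x)}` attached to the projection `π`. -/
noncomputable def subspaceP1 (π : C →ₗc[k] C) : Submodule k C :=
  LinearMap.eqLocus (Coalgebra.comul (R := k) (A := C)) (rhoL π + rhoR π)

end Coalgebras

/-! Everything is read off the convolution algebra A = H*. Evaluation at comatrix elements maps A
onto k^G × ∏ M_{n_i}(k). Its kernel J is the annihilator of H₀; it lies in the Jacobson radical,
hence is nilpotent. Wedges are dual to products, so H₁ is the annihilator of J², and dim H₁ = |G| +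
∑ n_i² + dim J/J². It remains to find 2n₁|G| dimensions in J/J², and to see that J² ≠ 0.

For the first, cut J/J² into Peirce pieces e(J/J²)e' by the diagonal matrix units. A nonzero piece
between two one-dimensional blocks yields a skew derivation A → k, that is, a skew-primitive outside
H₀ (`exists_derivation`, `mul_mul_mem_radSq`), which is excluded. For a one-dimensional block g,
neither e_g J nor J e_g lies in J². Otherwise a Nakayama argument gives a lift of e_g spanning a
one-sided ideal of dimension one; translated by g, it becomes an integral with nonzero value at 1,
and the dual Maschke theorem (`IsLeftIntegral.eq_top`) would make H cosemisimple. So every g is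
joined on each side to a block of size at least n₁, and matrix units spread this over all rows or
columns of that block, giving 2n₁ independent pieces for each g
(`two_mul_card_add_finrank_radSq_le`).

For J² ≠ 0, take a nonzero left integral t. By uniqueness kt is a two-sided ideal, so both actions
on t are characters of A, hence given by one-dimensional blocks; t lies in J since t(1) = 0. Thus t
is in a Peirce piece between one-dimensional blocks, and these lie in J².

Existence of t comes from a Hopf module structure on H*. The splitting H₁ = H₀ ⊕ P₁ is separate and
elementary. -/

namespace SplitQuotient

/-! ### Peirce components of the radical modulo its square -/

section

variable {k A : Type*} [Field k] [Ring A] [Algebra k A] {C : Type*} {d : C → ℕ}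
  (q : A →ₐ[k] ∀ c, Matrix (Fin (d c)) (Fin (d c)) k)

/-- The kernel of an algebra map to a product of matrix algebras, as a subspace. -/
abbrev rad : Submodule k A := LinearMap.ker q.toLinearMap

/-- The square of the ideal `rad q`. -/
abbrev radSq : Submodule k A := rad q * rad q

variable {q}

theorem mem_rad {x : A} : x ∈ rad q ↔ q x = 0 := by simp [rad]

theorem mul_mem_rad_left (a : A) {x : A} (hx : x ∈ rad q) : a * x ∈ rad q := by
  rw [mem_rad] at *; simp [hx]

theorem mul_mem_rad_right (a : A) {x : A} (hx : x ∈ rad q) : x * a ∈ rad q := by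
  rw [mem_rad] at *; simp [hx]

theorem sub_mem_rad {a b : A} (h : q a = q b) : a - b ∈ rad q := by
  rw [mem_rad]; simp [h]

theorem mul_mem_radSq {x y : A} (hx : x ∈ rad q) (hy : y ∈ rad q) : x * y ∈ radSq q :=
  Submodule.mul_mem_mul hx hy

theorem radSq_le : radSq q ≤ rad q :=
  Submodule.mul_le.2 fun x _ _ hy => mul_mem_rad_left x hy

theorem mul_mem_radSq_left (a : A) {z : A} (hz : z ∈ radSq q) : a * z ∈ radSq q := by
  induction hz using Submodule.mul_induction_on' with
  | mem_mul_mem x hx y hy => rw [← mul_assoc]; exact mul_mem_radSq (mul_mem_rad_left a hx) hy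
  | add x _ y _ hx hy => rw [mul_add]; exact add_mem hx hy

theorem mul_mem_radSq_right (a : A) {z : A} (hz : z ∈ radSq q) : z * a ∈ radSq q := by
  induction hz using Submodule.mul_induction_on' with
  | mem_mul_mem x hx y hy => rw [mul_assoc]; exact mul_mem_radSq hx (mul_mem_rad_right a hy)
  | add x _ y _ hx hy => rw [add_mul]; exact add_mem hx hy

theorem mul_sub_mul_mem_radSq_left {a b x : A} (h : q a = q b) (hx : x ∈ rad q) :
    a * x - b * x ∈ radSq q := by
  rw [← sub_mul]; exact mul_mem_radSq (sub_mem_rad h) hx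

theorem mul_sub_mul_mem_radSq_right {a b x : A} (h : q a = q b) (hx : x ∈ rad q) :
    x * a - x * b ∈ radSq q := by
  rw [← mul_sub]; exact mul_mem_radSq hx (sub_mem_rad h)

theorem mul_mem_radSq_congr_left {a b x : A} (h : q a = q b) (hx : x ∈ rad q)
    (ha : a * x ∈ radSq q) : b * x ∈ radSq q := by
  simpa using sub_mem ha (mul_sub_mul_mem_radSq_left h hx)

theorem mul_mem_radSq_congr_right {a b x : A} (h : q a = q b) (hx : x ∈ rad q)
    (ha : x * a ∈ radSq q) : x * b ∈ radSq q := by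
  simpa using sub_mem ha (mul_sub_mul_mem_radSq_right h hx)

theorem radSq_smul_mul {a b x : A} {m : k} (h : q a = m • q b) (hx : x ∈ rad q) :
    a * x - m • (b * x) ∈ radSq q := by
  rw [← smul_mul_assoc]
  exact mul_sub_mul_mem_radSq_left (by simpa using h) hx

theorem radSq_mul_smul {a b x : A} {m : k} (h : q a = m • q b) (hx : x ∈ rad q) :
    x * a - m • (x * b) ∈ radSq q := by
  rw [← mul_smul_comm]
  exact mul_sub_mul_mem_radSq_right (by simpa using h) hx

theorem finrank_rad_add_sum_sq [Fintype C] [Module.Finite k A] (hq : Function.Surjective q) :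
    Module.finrank k (rad q) + ∑ c, d c ^ 2 = Module.finrank k A := by
  rw [← LinearMap.finrank_range_add_finrank_ker q.toLinearMap,
    (LinearMap.range_eq_top.2 hq : q.toLinearMap.range = ⊤), finrank_top,
    Module.finrank_pi_fintype, add_comm]
  simp [Module.finrank_matrix, sq]

theorem algHom_eq_zero_of_mem_rad {N : ℕ} (hN : rad q ^ N = ⊥) (α : A →ₐ[k] k) {x : A}
    (hx : x ∈ rad q) : α x = 0 := by
  have h : x ^ N ∈ rad q ^ N := Submodule.pow_mem_pow _ hx N
  rw [hN, Submodule.mem_bot] at h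
  exact eq_zero_of_pow_eq_zero (n := N) (by rw [← map_pow, h, map_zero])

variable [DecidableEq C]

variable (k d) in
/-- The matrix unit `e r s` of the factor of index `c`. -/
def matUnit (c : C) (r s : Fin (d c)) : ∀ c, Matrix (Fin (d c)) (Fin (d c)) k :=
  Pi.single c (Matrix.single r s 1)

theorem matUnit_mul_same (c : C) (r s u : Fin (d c)) :
    matUnit k d c r s * matUnit k d c s u = matUnit k d c r u := by
  simp [matUnit, ← Pi.single_mul]

theorem matUnit_mul_of_ne (c : C) (r s s' u : Fin (d c)) (h : s ≠ s') :
    matUnit k d c r s * matUnit k d c s' u = 0 := by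
  simp [matUnit, ← Pi.single_mul, h]

theorem matUnit_mul_of_ne' {c c' : C} (h : c ≠ c') (r s : Fin (d c)) (r' s' : Fin (d c')) :
    matUnit k d c r s * matUnit k d c' r' s' = 0 := by
  simp only [matUnit]
  ext i : 1
  by_cases hi : i = c
  · subst hi; simp [h]
  · simp [hi]

theorem sum_matUnit [Fintype C] :
    ∑ p : (c : C) × Fin (d c), matUnit k d p.1 p.2 p.2 = 1 := by
  rw [Fintype.sum_sigma]
  ext c i j
  simp only [matUnit, Finset.sum_apply, Matrix.sum_apply, Pi.one_apply]
  rw [Finset.sum_eq_single c]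
  · simp [Matrix.single_apply, Matrix.one_apply, ite_and]
  · intro c' _ hc; simp [hc.symm]
  · simp

theorem matUnit_mul_of_eq_one {c : C} (hc : d c = 1) (r : Fin (d c))
    (b : ∀ c, Matrix (Fin (d c)) (Fin (d c)) k) :
    matUnit k d c r r * b = b c r r • matUnit k d c r r := by
  have : Subsingleton (Fin (d c)) := by rw [hc]; infer_instance
  ext c' i j
  by_cases h : c' = c
  · subst h
    obtain rfl := Subsingleton.elim r i
    obtain rfl := Subsingleton.elim r j
    simp [matUnit]
  · simp [matUnit, h]

theorem mul_matUnit_of_eq_one {c : C} (hc : d c = 1) (r : Fin (d c))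
    (b : ∀ c, Matrix (Fin (d c)) (Fin (d c)) k) :
    b * matUnit k d c r r = b c r r • matUnit k d c r r := by
  have : Subsingleton (Fin (d c)) := by rw [hc]; infer_instance
  ext c' i j
  by_cases h : c' = c
  · subst h
    obtain rfl := Subsingleton.elim r i
    obtain rfl := Subsingleton.elim r j
    simp [matUnit]
  · simp [matUnit, h]

@[simp] theorem matUnit_self_apply (c : C) (r : Fin (d c)) : matUnit k d c r r c r r = 1 := by
  simp [matUnit]

/-- A choice of lifts of the matrix units along a surjective map. -/
noncomputable def liftUnit (hq : Function.Surjective q) (c : C) (r s : Fin (d c)) : A :=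
  (hq (matUnit k d c r s)).choose

@[simp] theorem map_liftUnit (hq : Function.Surjective q) (c : C) (r s : Fin (d c)) :
    q (liftUnit hq c r s) = matUnit k d c r s :=
  (hq (matUnit k d c r s)).choose_spec

/-- Two-sided Peirce components, indexed by pairs of primitive idempotents, are independent modulo
the square of the radical. -/
theorem card_add_finrank_radSq_le [Module.Finite k A] (hq : Function.Surjective q)
    {S : Type*} [Fintype S] (f : S → ((c : C) × Fin (d c)) × ((c : C) × Fin (d c)))
    (hf : Function.Injective f)
    (hS : ∀ s, ∃ x ∈ rad q, liftUnit hq (f s).1.1 (f s).1.2 (f s).1.2 * x *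
      liftUnit hq (f s).2.1 (f s).2.2 (f s).2.2 ∉ radSq q) :
    Fintype.card S + Module.finrank k (radSq q) ≤ Module.finrank k (rad q) := by
  classical
  choose x hx hxn using hS
  let U (p : (c : C) × Fin (d c)) : A := liftUnit hq p.1 p.2 p.2
  have hU (p p') : q (U p * U p') = if p = p' then q (U p) else 0 := by
    obtain ⟨c, r⟩ := p
    obtain ⟨c', r'⟩ := p'
    simp only [U, map_mul, map_liftUnit]
    by_cases h : c = c'
    · subst h
      by_cases h' : r = r'
      · subst h'; simp [matUnit_mul_same]
      · simp [h', matUnit_mul_of_ne _ _ _ _ _ h']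
    · simp [h, matUnit_mul_of_ne' h]
  let u (s : S) : A := U (f s).1 * x s * U (f s).2
  have hu (s) : u s ∈ rad q := mul_mem_rad_right _ (mul_mem_rad_left _ (hx s))
  -- The lifts are orthogonal idempotents only modulo the radical. As `x s'` is itself in the
  -- radical, the errors fall in its square, so sandwiching isolates one coefficient of a linear
  -- relation.
  have key (s s') : U (f s).1 * u s' * U (f s).2 - (if s = s' then u s' else 0) ∈ radSq q := by
    have h1 : U (f s).1 * u s' * U (f s).2 =
        (U (f s).1 * U (f s').1) * (x s' * (U (f s').2 * U (f s).2)) := by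
      simp only [u, mul_assoc]
    rw [h1]
    by_cases hs : s = s'
    · subst hs
      rw [if_pos rfl]
      have e1 := mul_sub_mul_mem_radSq_left (q := q) (a := U (f s).1 * U (f s).1) (b := U (f s).1)
        (by rw [hU, if_pos rfl]) (mul_mem_rad_right (U (f s).2 * U (f s).2) (hx s))
      have e2 := mul_sub_mul_mem_radSq_right (q := q) (a := U (f s).2 * U (f s).2) (b := U (f s).2)
        (by rw [hU, if_pos rfl]) (mul_mem_rad_left (U (f s).1) (hx s))
      have := add_mem e1 e2
      convert this using 1
      simp only [u, mul_assoc]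
      abel
    · rw [if_neg hs, sub_zero]
      by_cases h' : (f s).1 = (f s').1
      · have h2 : (f s').2 ≠ (f s).2 := fun h2 => hs (hf (Prod.ext h' h2.symm))
        refine mul_mem_radSq_left _ (mul_mem_radSq (hx s') ?_)
        rw [mem_rad, hU, if_neg h2]
      · refine mul_mem_radSq ?_ (mul_mem_rad_right _ (hx s'))
        rw [mem_rad, hU, if_neg h']
  have hli : LinearIndependent k fun s => ((radSq q).comap (rad q).subtype).mkQ ⟨u s, hu s⟩ := by
    rw [Fintype.linearIndependent_iff]
    intro g hg s
    by_contra hgs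
    apply hxn s
    simp only [← map_smul, ← map_sum] at hg
    rw [Submodule.mkQ_apply, Submodule.Quotient.mk_eq_zero] at hg
    have hg' : ∑ i, g i • u i ∈ radSq q := by simpa using hg
    have h1 := mul_mem_radSq_right (U (f s).2) (mul_mem_radSq_left (U (f s).1) hg')
    rw [Finset.mul_sum, Finset.sum_mul] at h1
    have h2 : ∑ i, g i • (U (f s).1 * u i * U (f s).2 - (if s = i then u i else 0)) ∈ radSq q :=
      sum_mem fun i _ => Submodule.smul_mem _ _ (key s i)
    have h3 := sub_mem h1 h2
    rw [← Finset.sum_sub_distrib] at h3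
    have h4 : g s • u s ∈ radSq q := by
      convert h3 using 1
      simp [smul_sub]
    exact (Submodule.smul_mem_iff _ hgs).1 h4
  have h1 := hli.fintype_card_le_finrank
  have h2 := Submodule.finrank_quotient_add_finrank ((radSq q).comap (rad q).subtype)
  have h3 : Module.finrank k ((radSq q).comap (rad q).subtype) = Module.finrank k (radSq q) :=
    (Submodule.comapSubtypeEquivOfLe radSq_le).finrank_eq
  omega

theorem exists_liftUnit_mul_notMem_radSq [Fintype C] (hq : Function.Surjective q) {x : A}
    (hx : x ∈ rad q) (hxn : x ∉ radSq q) : ∃ c r, liftUnit hq c r r * x ∉ radSq q := by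
  by_contra! h
  have h1 : ∑ p : (c : C) × Fin (d c), liftUnit hq p.1 p.2 p.2 * x ∈ radSq q :=
    sum_mem fun p _ => h p.1 p.2
  rw [← Finset.sum_mul] at h1
  apply hxn
  simpa using mul_mem_radSq_congr_left (b := 1) (by simp [sum_matUnit]) hx h1

theorem exists_mul_liftUnit_notMem_radSq [Fintype C] (hq : Function.Surjective q) {x : A}
    (hx : x ∈ rad q) (hxn : x ∉ radSq q) : ∃ c r, x * liftUnit hq c r r ∉ radSq q := by
  by_contra! h
  have h1 : ∑ p : (c : C) × Fin (d c), x * liftUnit hq p.1 p.2 p.2 ∈ radSq q :=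
    sum_mem fun p _ => h p.1 p.2
  rw [← Finset.mul_sum] at h1
  apply hxn
  simpa using mul_mem_radSq_congr_right (b := 1) (by simp [sum_matUnit]) hx h1

theorem liftUnit_mul_mul_notMem_radSq (hq : Function.Surjective q) {x : A} (hx : x ∈ rad q)
    {c : C} {r : Fin (d c)} (h : liftUnit hq c r r * x ∉ radSq q) (s : Fin (d c)) :
    liftUnit hq c s s * (liftUnit hq c s r * x) ∉ radSq q := fun h' => h <| by
  have h1 := mul_mem_radSq_left (liftUnit hq c r s) h'
  rw [← mul_assoc, ← mul_assoc] at h1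
  refine mul_mem_radSq_congr_left ?_ hx h1
  simp [matUnit_mul_same]

theorem mul_mul_liftUnit_notMem_radSq (hq : Function.Surjective q) {x : A} (hx : x ∈ rad q)
    {c : C} {r : Fin (d c)} (h : x * liftUnit hq c r r ∉ radSq q) (s : Fin (d c)) :
    x * liftUnit hq c r s * liftUnit hq c s s ∉ radSq q := fun h' => h <| by
  have h1 := mul_mem_radSq_right (liftUnit hq c s r) h'
  rw [mul_assoc, mul_assoc] at h1
  refine mul_mem_radSq_congr_right ?_ hx h1
  simp [matUnit_mul_same]

/-- If no Peirce component between two one-dimensional blocks survives modulo the square of the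
radical, while each one-dimensional block acts nontrivially on both sides, then the dimension of
the radical modulo its square is at least `2 m` times the number of one-dimensional blocks, where
`m` is a lower bound for the sizes of the other blocks. -/
theorem two_mul_card_add_finrank_radSq_le [Fintype C] [Module.Finite k A]
    (hq : Function.Surjective q) {m : ℕ} (hm : ∀ c, d c ≠ 1 → m ≤ d c)
    (hr : ∀ c r, d c = 1 → ∃ x ∈ rad q, x * liftUnit hq c r r ∉ radSq q)
    (hl : ∀ c r, d c = 1 → ∃ x ∈ rad q, liftUnit hq c r r * x ∉ radSq q)
    (h1 : ∀ c r c' r', d c = 1 → d c' = 1 → ∀ x ∈ rad q,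
      liftUnit hq c r r * x * liftUnit hq c' r' r' ∈ radSq q) :
    2 * m * Fintype.card {c // d c = 1} + Module.finrank k (radSq q) ≤
      Module.finrank k (rad q) := by
  -- The diagonal units sum to 1, so some e_rr x e_g survives; `h1` forces its block to be of size
  -- other than 1, and multiplying by e_sr carries the element to every row s.
  have HL (g : {c // d c = 1}) : ∃ c, d c ≠ 1 ∧ ∀ s, ∃ x ∈ rad q,
      liftUnit hq c s s * x * liftUnit hq g.1 ⟨0, by omega⟩ ⟨0, by omega⟩ ∉ radSq q := by
    obtain ⟨g, hg⟩ := g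
    obtain ⟨x, hx, hxn⟩ := hr g ⟨0, by omega⟩ hg
    have hx' := mul_mem_rad_right (liftUnit hq g ⟨0, by omega⟩ ⟨0, by omega⟩) hx
    obtain ⟨c, r, hc⟩ := exists_liftUnit_mul_notMem_radSq hq hx' hxn
    refine ⟨c, fun hc1 => hc ?_, fun s => ⟨liftUnit hq c s r * x, mul_mem_rad_left _ hx, ?_⟩⟩
    · rw [← mul_assoc]
      exact h1 _ _ _ _ hc1 hg x hx
    · have := liftUnit_mul_mul_notMem_radSq hq hx' hc s
      simpa only [mul_assoc] using this
  have HR (g : {c // d c = 1}) : ∃ c, d c ≠ 1 ∧ ∀ s, ∃ x ∈ rad q,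
      liftUnit hq g.1 ⟨0, by omega⟩ ⟨0, by omega⟩ * x * liftUnit hq c s s ∉ radSq q := by
    obtain ⟨g, hg⟩ := g
    obtain ⟨x, hx, hxn⟩ := hl g ⟨0, by omega⟩ hg
    have hx' := mul_mem_rad_left (liftUnit hq g ⟨0, by omega⟩ ⟨0, by omega⟩) hx
    obtain ⟨c, r, hc⟩ := exists_mul_liftUnit_notMem_radSq hq hx' hxn
    refine ⟨c, fun hc1 => hc ?_, fun s => ⟨x * liftUnit hq c r s, mul_mem_rad_right _ hx, ?_⟩⟩
    · exact h1 _ _ _ _ hg hc1 x hx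
    · have := mul_mul_liftUnit_notMem_radSq hq hx' hc s
      simpa only [mul_assoc] using this
  choose L hL1 hL using HL
  choose R hR1 hR using HR
  let o (g : {c // d c = 1}) : (c : C) × Fin (d c) := ⟨g.1, ⟨0, by omega⟩⟩
  let l (g : {c // d c = 1}) (s : Fin m) : (c : C) × Fin (d c) :=
    ⟨L g, Fin.castLE (hm _ (hL1 g)) s⟩
  let r (g : {c // d c = 1}) (s : Fin m) : (c : C) × Fin (d c) :=
    ⟨R g, Fin.castLE (hm _ (hR1 g)) s⟩
  let f : ({c // d c = 1} × Fin m) ⊕ ({c // d c = 1} × Fin m) →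
      ((c : C) × Fin (d c)) × ((c : C) × Fin (d c)) :=
    Sum.elim (fun p => (l p.1 p.2, o p.1)) (fun p => (o p.1, r p.1 p.2))
  -- A left and a right pair never coincide: the first entry is in a block of size other than 1 for
  -- the former, and of size 1 for the latter.
  have ho (g g') (h : o g = o g') : g = g' := Subtype.ext (congrArg Sigma.fst h)
  have hf : Function.Injective f := by
    rintro (⟨g, s⟩ | ⟨g, s⟩) (⟨g', s'⟩ | ⟨g', s'⟩) h
    · simp only [f, Sum.elim_inl, Prod.mk.injEq] at h
      obtain rfl := ho _ _ h.2
      simpa [l] using h.1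
    · simp only [f, Sum.elim_inl, Sum.elim_inr, Prod.mk.injEq] at h
      exact absurd ((congrArg d (congrArg Sigma.fst h.1)).trans g'.2) (hL1 g)
    · simp only [f, Sum.elim_inl, Sum.elim_inr, Prod.mk.injEq] at h
      exact absurd ((congrArg d (congrArg Sigma.fst h.1)).symm.trans g.2) (hL1 g')
    · simp only [f, Sum.elim_inr, Prod.mk.injEq] at h
      obtain rfl := ho _ _ h.1
      simpa [r] using h.2
  have := card_add_finrank_radSq_le hq f hf (by
    rintro (⟨g, s⟩ | ⟨g, s⟩)
    · exact hL g _
    · exact hR g _)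
  simp only [Fintype.card_sum, Fintype.card_prod, Fintype.card_fin] at this
  linarith [this]

/-- If the radical times a one-dimensional block vanishes modulo its square, then some lift of the
idempotent of this block spans a one-dimensional left ideal. -/
theorem exists_mul_eq_smul (hq : Function.Surjective q) {N : ℕ} (hN : rad q ^ N = ⊥) {c : C}
    (hc : d c = 1) (r : Fin (d c)) (h : ∀ x ∈ rad q, x * liftUnit hq c r r ∈ radSq q) :
    ∃ e, q e c r r = 1 ∧ ∀ a, a * e = q a c r r • e := by
  set e := liftUnit hq c r r with he
  -- Nakayama: each right multiplication by e gains one power of the radical, so a high power of e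
  -- kills the radical from the right.
  have hpow (n : ℕ) : ∀ x ∈ rad q ^ (n + 1), x * e ∈ rad q ^ (n + 2) := by
    intro x hx
    rw [pow_succ] at hx
    induction hx using Submodule.mul_induction_on' with
    | mem_mul_mem x hx y hy =>
      rw [mul_assoc, pow_add, pow_two]
      exact Submodule.mul_mem_mul hx (h y hy)
    | add x _ y _ hx hy => rw [add_mul]; exact add_mem hx hy
  have hpow' (n : ℕ) : ∀ x ∈ rad q, x * e ^ n ∈ rad q ^ (n + 1) := by
    intro x hx
    induction n with
    | zero => simpa using hx
    | succ n ih => rw [pow_succ e, ← mul_assoc]; exact hpow n _ ih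
  have hzero : ∀ x ∈ rad q, x * e ^ (N + 1) = 0 := by
    intro x hx
    have := hpow' (N + 1) x hx
    rwa [add_assoc, pow_add, hN, Submodule.bot_mul, Submodule.mem_bot] at this
  have hqe (n : ℕ) : q (e ^ (n + 1)) = matUnit k d c r r := by
    induction n with
    | zero => simp [he]
    | succ n ih => rw [pow_succ, map_mul, ih, he, map_liftUnit, matUnit_mul_same]
  -- The first factor makes the difference of a and its scalar fall in the radical; the second kills
  -- that difference.
  refine ⟨e ^ (N + 1) * e ^ (N + 1),
    by rw [map_mul, hqe, matUnit_mul_same, matUnit_self_apply], fun a => ?_⟩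
  have h1 : a * e ^ (N + 1) - q a c r r • e ^ (N + 1) ∈ rad q := by
    rw [mem_rad, map_sub, map_mul, map_smul, hqe, mul_matUnit_of_eq_one hc, sub_self]
  have h2 := hzero _ h1
  rwa [sub_mul, sub_eq_zero, mul_assoc, smul_mul_assoc] at h2

/-- If a one-dimensional block times the radical vanishes modulo its square, then some lift of the
idempotent of this block spans a one-dimensional right ideal. -/
theorem exists_mul_eq_smul' (hq : Function.Surjective q) {N : ℕ} (hN : rad q ^ N = ⊥) {c : C}
    (hc : d c = 1) (r : Fin (d c)) (h : ∀ x ∈ rad q, liftUnit hq c r r * x ∈ radSq q) :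
    ∃ e, q e c r r = 1 ∧ ∀ a, e * a = q a c r r • e := by
  set e := liftUnit hq c r r with he
  have hpow (n : ℕ) : ∀ x ∈ rad q ^ (n + 1), e * x ∈ rad q ^ (n + 2) := by
    intro x hx
    rw [pow_succ'] at hx
    induction hx using Submodule.mul_induction_on' with
    | mem_mul_mem x hx y hy =>
      rw [← mul_assoc, add_comm n, pow_add, pow_two]
      exact Submodule.mul_mem_mul (h x hx) hy
    | add x _ y _ hx hy => rw [mul_add]; exact add_mem hx hy
  have hpow' (n : ℕ) : ∀ x ∈ rad q, e ^ n * x ∈ rad q ^ (n + 1) := by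
    intro x hx
    induction n with
    | zero => simpa using hx
    | succ n ih => rw [pow_succ' e, mul_assoc]; exact hpow n _ ih
  have hzero : ∀ x ∈ rad q, e ^ (N + 1) * x = 0 := by
    intro x hx
    have := hpow' (N + 1) x hx
    rwa [add_assoc, pow_add, hN, Submodule.bot_mul, Submodule.mem_bot] at this
  have hqe (n : ℕ) : q (e ^ (n + 1)) = matUnit k d c r r := by
    induction n with
    | zero => simp [he]
    | succ n ih => rw [pow_succ, map_mul, ih, he, map_liftUnit, matUnit_mul_same]
  refine ⟨e ^ (N + 1) * e ^ (N + 1),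
    by rw [map_mul, hqe, matUnit_mul_same, matUnit_self_apply], fun a => ?_⟩
  have h1 : e ^ (N + 1) * a - q a c r r • e ^ (N + 1) ∈ rad q := by
    rw [mem_rad, map_sub, map_mul, map_smul, hqe, matUnit_mul_of_eq_one hc, sub_self]
  have h2 := hzero _ h1
  rwa [mul_sub, sub_eq_zero, ← mul_assoc, mul_smul_comm] at h2

/-- A Peirce component between one-dimensional blocks which survives modulo the square of the
radical is detected by a skew derivation. -/
theorem exists_derivation (hq : Function.Surjective q) {c c' : C} (hc : d c = 1) (hc' : d c' = 1)
    (r : Fin (d c)) (r' : Fin (d c')) {x : A} (hx : x ∈ rad q)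
    (h : liftUnit hq c r r * x * liftUnit hq c' r' r' ∉ radSq q) :
    ∃ X : A →ₗ[k] k, X x ≠ 0 ∧ ∀ a b, X (a * b) = X a * q b c' r' r' + q a c r r * X b := by
  set e := liftUnit hq c r r with he
  set e' := liftUnit hq c' r' r' with he'
  obtain ⟨l, hl, hlx⟩ := Submodule.exists_le_ker_of_notMem h
  have hl0 {a b : A} (hab : a - b ∈ radSq q) : l a = l b := by
    rw [← sub_eq_zero, ← map_sub]; exact hlx hab
  let l' : A →ₗ[k] k := l ∘ₗ LinearMap.mulRight k e' ∘ₗ LinearMap.mulLeft k e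
  have hl' (z : A) : l' z = l (e * z * e') := rfl
  have hL (a z : A) (hz : z ∈ rad q) : l' (a * z) = q a c r r * l' z := by
    rw [hl', hl', ← smul_eq_mul (q a c r r), ← map_smul]
    apply hl0
    have := radSq_smul_mul (q := q) (a := e * a) (b := e) (m := q a c r r)
      (by rw [map_mul, he, map_liftUnit, matUnit_mul_of_eq_one hc]) (mul_mem_rad_right e' hz)
    simpa only [mul_assoc] using this
  have hR (a z : A) (hz : z ∈ rad q) : l' (z * a) = l' z * q a c' r' r' := by
    rw [hl', hl', mul_comm (l _), ← smul_eq_mul (q a c' r' r'), ← map_smul]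
    apply hl0
    have := radSq_mul_smul (q := q) (a := a * e') (b := e') (m := q a c' r' r')
      (by rw [map_mul, he', map_liftUnit, mul_matUnit_of_eq_one hc']) (mul_mem_rad_left e hz)
    simpa only [mul_assoc] using this
  let ev : A →ₗ[k] k :=
    { toFun := fun a => q a c r r
      map_add' := by simp
      map_smul' := by simp }
  -- With χ(a) = q a c r r, the map a ↦ ea − χ(a)e takes values in the radical, where `l'` is
  -- multiplicative on each side through the two characters (`hL`, `hR`). The derivation rule
  -- follows.
  let X : A →ₗ[k] k := l' ∘ₗ LinearMap.mulLeft k e - l' e • ev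
  have hX (a : A) : X a = l' (e * a - q a c r r • e) := by
    simp [X, ev, mul_comm]
  have hmem (a : A) : e * a - q a c r r • e ∈ rad q := by
    rw [mem_rad, map_sub, map_mul, map_smul, he, map_liftUnit, matUnit_mul_of_eq_one hc, sub_self]
  refine ⟨X, ?_, fun a b => ?_⟩
  · rw [hX, mem_rad.1 hx]
    simp only [Pi.zero_apply, Matrix.zero_apply, zero_smul, sub_zero]
    rw [hL _ _ hx, he, map_liftUnit, matUnit_self_apply, one_mul]
    exact hl
  · have h1 : e * (a * b) - q (a * b) c r r • e =
        (e * a - q a c r r • e) * b + q a c r r • (e * b - q b c r r • e) := by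
      have h2 : q (a * b) c r r = q a c r r * q b c r r := by
        have : Subsingleton (Fin (d c)) := by rw [hc]; infer_instance
        rw [map_mul, Pi.mul_apply, Matrix.mul_apply, Fintype.sum_subsingleton _ r]
      rw [h2]
      simp only [sub_mul, smul_sub, smul_mul_assoc, mul_smul, mul_assoc]
      abel
    rw [hX, h1, map_add, hR _ _ (hmem a), map_smul, hX, hX, smul_eq_mul]

/-- The characters of the algebra are given by the one-dimensional blocks. -/
theorem exists_eq_block_of_algHom [Fintype C] (hq : Function.Surjective q) {N : ℕ}
    (hN : rad q ^ N = ⊥) (α : A →ₐ[k] k) : ∃ c r, d c = 1 ∧ ∀ a, α a = q a c r r := by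
  have hα {a b : A} (h : q a = q b) : α a = α b := by
    rw [← sub_eq_zero, ← map_sub]
    exact algHom_eq_zero_of_mem_rad hN α (sub_mem_rad h)
  have h1 : ∑ p : (c : C) × Fin (d c), α (liftUnit hq p.1 p.2 p.2) = 1 := by
    rw [← map_sum, ← map_one α]
    exact hα (by simp [sum_matUnit])
  obtain ⟨⟨c, r⟩, -, hcr⟩ := Finset.exists_ne_zero_of_sum_ne_zero (h1.trans_ne one_ne_zero)
  simp only at hcr
  -- A second index s would give α(e_rr) = α(e_ss) by commutativity of k, while their product is
  -- α(e_rr e_ss) = 0.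
  have hsub (s : Fin (d c)) : s = r := by
    by_contra hs
    have e1 : α (liftUnit hq c r r) = α (liftUnit hq c r s) * α (liftUnit hq c s r) := by
      rw [← map_mul]; exact hα (by simp [matUnit_mul_same])
    have e2 : α (liftUnit hq c s s) = α (liftUnit hq c s r) * α (liftUnit hq c r s) := by
      rw [← map_mul]; exact hα (by simp [matUnit_mul_same])
    have e3 : α (liftUnit hq c r r) * α (liftUnit hq c s s) = 0 := by
      rw [← map_mul, ← map_zero α]
      exact hα (by simp [matUnit_mul_of_ne _ _ _ _ _ (Ne.symm hs)])
    rw [e2, mul_comm (α (liftUnit hq c s r)), ← e1] at e3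
    exact hcr (mul_self_eq_zero.1 e3)
  have hc : d c = 1 := by
    have : Subsingleton (Fin (d c)) := ⟨fun a b => (hsub a).trans (hsub b).symm⟩
    have h2 := Fintype.card_le_one_iff_subsingleton.2 this
    rw [Fintype.card_fin] at h2
    have := r.pos
    omega
  refine ⟨c, r, hc, fun a => ?_⟩
  have e1 : α a * α (liftUnit hq c r r) = q a c r r * α (liftUnit hq c r r) := by
    rw [← map_mul, ← smul_eq_mul (q a c r r), ← map_smul]
    exact hα (by simp [mul_matUnit_of_eq_one hc])
  exact mul_right_cancel₀ hcr e1

end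

end SplitQuotient

/-! ### Coinvariants of Hopf modules -/

section HopfModule

open Coalgebra HopfAlgebra WithConv LinearMap

variable {k H : Type*} [Field k] [Ring H] [HopfAlgebra k H]

/-- The map `x ↦ x ⊗ 1` as an algebra map. -/
local notation "iL" => (Algebra.TensorProduct.includeLeft : H →ₐ[k] H ⊗[k] H)
/-- The map `x ↦ 1 ⊗ x` as an algebra map. -/
local notation "iR" => (Algebra.TensorProduct.includeRight : H →ₐ[k] H ⊗[k] H)

namespace HopfAlgebra

theorem toConv_comp_mul {B : Type*} [Ring B] [Algebra k B] {D : Type*} [Ring D] [Algebra k D]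
    (h : B →ₐ[k] D) (f g : H →ₗ[k] B) :
    toConv (h.toLinearMap ∘ₗ f) * toConv (h.toLinearMap ∘ₗ g) =
      toConv (h.toLinearMap ∘ₗ (toConv f * toConv g).ofConv) :=
  (WithConv.ext (algHom_comp_convMul_distrib h (toConv f) (toConv g))).symm

theorem toConv_comp_one {B : Type*} [Ring B] [Algebra k B] {D : Type*} [Ring D] [Algebra k D]
    (h : B →ₐ[k] D) :
    toConv (h.toLinearMap ∘ₗ (1 : WithConv (H →ₗ[k] B)).ofConv) = 1 := by
  ext x
  simp [LinearMap.convOne_def]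

theorem comul_conv_left_inv :
    toConv ((comul : H →ₗ[k] H ⊗[k] H) ∘ₗ antipode k) * toConv (comul : H →ₗ[k] H ⊗[k] H) = 1 := by
  have := toConv_comp_mul (Bialgebra.comulAlgHom k H) (antipode k) LinearMap.id
  rw [antipode_mul_id, toConv_comp_one] at this
  exact this

theorem includeLeft_mul_includeRight :
    toConv (iL).toLinearMap * toConv (iR).toLinearMap = toConv (comul : H →ₗ[k] H ⊗[k] H) := by
  ext x
  rw [(ℛ k x).convMul_apply]
  simp [(ℛ k x).eq]

/-- Δ ∘ S is the convolution inverse of Δ = `iL` * `iR`, so it can be cancelled. This replaces the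
rule that S reverses coproducts. -/
theorem includeRight_mul_comul_antipode :
    toConv (iR).toLinearMap * toConv ((comul : H →ₗ[k] H ⊗[k] H) ∘ₗ antipode k) =
      toConv ((iL).toLinearMap ∘ₗ antipode k) := by
  have h1 : toConv ((iL).toLinearMap ∘ₗ antipode k) * toConv (comul : H →ₗ[k] H ⊗[k] H) =
      toConv (iR).toLinearMap := by
    rw [← includeLeft_mul_includeRight, ← mul_assoc]
    have := toConv_comp_mul (iL) (antipode k) LinearMap.id
    rw [antipode_mul_id, toConv_comp_one] at this
    rw [LinearMap.comp_id] at this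
    rw [this, one_mul]
  rw [← h1, mul_assoc, comul_right_inv, mul_one]

theorem comul_antipode_mul_includeLeft :
    toConv ((comul : H →ₗ[k] H ⊗[k] H) ∘ₗ antipode k) * toConv (iL).toLinearMap =
      toConv ((iR).toLinearMap ∘ₗ antipode k) := by
  have h1 : toConv (comul : H →ₗ[k] H ⊗[k] H) * toConv ((iR).toLinearMap ∘ₗ antipode k) =
      toConv (iL).toLinearMap := by
    rw [← includeLeft_mul_includeRight, mul_assoc]
    have := toConv_comp_mul (iR) LinearMap.id (antipode k)
    rw [id_mul_antipode, toConv_comp_one] at this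
    rw [LinearMap.comp_id] at this
    rw [this, mul_one]
  rw [← h1, ← mul_assoc, comul_conv_left_inv, one_mul]

end HopfAlgebra

/-- A right Hopf module over a Hopf algebra. -/
structure HopfModuleData (k H M : Type*) [Field k] [Ring H] [HopfAlgebra k H] [AddCommGroup M]
    [Module k M] where
  /-- The coaction. -/
  coact : M →ₗ[k] M ⊗[k] H
  /-- The action. -/
  act : M ⊗[k] H →ₗ[k] M
  coact_counit : ∀ m, TensorProduct.rid k M (counit.lTensor M (coact m)) = m
  coact_coassoc : ∀ m, TensorProduct.assoc k M H H (coact.rTensor H (coact m)) =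
    comul.lTensor M (coact m)
  act_one : ∀ m, act (m ⊗ₜ 1) = m
  act_mul : ∀ m x y, act (act (m ⊗ₜ x) ⊗ₜ y) = act (m ⊗ₜ (x * y))
  coact_act : ∀ m x, coact (act (m ⊗ₜ x)) =
    TensorProduct.map act (mul' k H)
      (TensorProduct.tensorTensorTensorComm k M H H H (coact m ⊗ₜ comul x))

namespace HopfModuleData

variable {M : Type*} [AddCommGroup M] [Module k M] (D : HopfModuleData k H M)

/-- The projection `m ↦ m₀ S(m₁)` onto the coinvariants. -/
noncomputable def proj : M →ₗ[k] M := D.act ∘ₗ (antipode k).lTensor M ∘ₗ D.coact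

theorem act_proj (m : M) : D.act (D.proj.rTensor H (D.coact m)) = m := by
  -- In Sweedler notation the computation is m₀ S(m₁) m₂ = m.
  let V : M ⊗[k] (H ⊗[k] H) →ₗ[k] M :=
    D.act ∘ₗ (mul' k H ∘ₗ (antipode k).rTensor H).lTensor M
  have h1 (u : M ⊗[k] H) : D.act (D.proj.rTensor H u) =
      V (TensorProduct.assoc k M H H (D.coact.rTensor H u)) := by
    induction u with
    | zero => simp
    | add u v hu hv => simp only [map_add, hu, hv]
    | tmul m y =>
      simp only [rTensor_tmul, proj, comp_apply]
      generalize D.coact m = w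
      induction w with
      | zero => simp
      | add u v hu hv => simp only [map_add, TensorProduct.add_tmul, hu, hv]
      | tmul n x => simp [V, D.act_mul]
  rw [h1, D.coact_coassoc]
  have h2 : V (comul.lTensor M (D.coact m)) =
      D.act ((mul' k H ∘ₗ (antipode k).rTensor H ∘ₗ comul).lTensor M (D.coact m)) := by
    simp only [V, comp_apply, ← lTensor_comp_apply, LinearMap.comp_assoc]
  rw [h2, mul_antipode_rTensor_comul]
  conv_rhs => rw [← D.coact_counit m]
  generalize D.coact m = w
  induction w with
  | zero => simp
  | add u v hu hv => simp only [map_add, hu, hv]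
  | tmul n x => simp [Algebra.algebraMap_eq_smul_one, D.act_one]

theorem coact_proj (m : M) : D.coact (D.proj m) = D.proj m ⊗ₜ 1 := by
  -- The coaction of m₀ S(m₁) is m₀ S(m₂)₁ ⊗ m₁ S(m₂)₂, and (1 ⊗ x₁) Δ(S(x₂)) = S(x) ⊗ 1 collapses
  -- the last two legs.
  let T : M ⊗[k] (H ⊗[k] H) →ₗ[k] M ⊗[k] H :=
    D.act.rTensor H ∘ₗ (TensorProduct.assoc k M H H).symm.toLinearMap
  let Ψ : H ⊗[k] H →ₗ[k] H ⊗[k] H :=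
    mul' k (H ⊗[k] H) ∘ₗ TensorProduct.map (iR).toLinearMap (comul ∘ₗ antipode k)
  have hΨ : Ψ ∘ₗ comul = (iL).toLinearMap ∘ₗ antipode k :=
    congrArg WithConv.ofConv (includeRight_mul_comul_antipode (k := k) (H := H))
  have h1 (u : M ⊗[k] H) : D.coact (D.act ((antipode k).lTensor M u)) =
      T (Ψ.lTensor M (TensorProduct.assoc k M H H (D.coact.rTensor H u))) := by
    induction u with
    | zero => simp
    | add u v hu hv => simp only [map_add, hu, hv]
    | tmul m y =>
      simp only [rTensor_tmul, lTensor_tmul, D.coact_act]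
      generalize D.coact m = w
      induction w with
      | zero => simp
      | add u v hu hv => simp only [map_add, TensorProduct.add_tmul, hu, hv]
      | tmul n x =>
        simp only [TensorProduct.assoc_tmul, lTensor_tmul, Ψ, comp_apply, TensorProduct.map_tmul,
          mul'_apply, AlgHom.toLinearMap_apply, Algebra.TensorProduct.includeRight_apply]
        generalize comul (R := k) (antipode k y) = z
        induction z with
        | zero => simp
        | add u v hu hv => simp only [map_add, TensorProduct.tmul_add, mul_add, hu, hv]
        | tmul a b => simp [T]
  have h2 : D.coact (D.proj m) =
      T ((Ψ ∘ₗ comul).lTensor M (D.coact m)) := by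
    simp only [proj, comp_apply]
    rw [h1, D.coact_coassoc]
    exact congrArg T (lTensor_comp_apply M Ψ comul _).symm
  rw [h2, hΨ]
  simp only [proj, comp_apply]
  generalize D.coact m = w
  induction w with
  | zero => simp
  | add u v hu hv => simp only [map_add, TensorProduct.add_tmul, hu, hv]
  | tmul n x => simp [T]

/-- A nonzero Hopf module has a nonzero coinvariant. -/
theorem exists_ne_zero_coact_eq [Nontrivial M] : ∃ m : M, m ≠ 0 ∧ D.coact m = m ⊗ₜ 1 := by
  by_contra! h
  have h0 : D.proj = 0 := by
    ext m
    by_contra hm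
    exact h _ hm (D.coact_proj m)
  obtain ⟨m, hm⟩ := exists_ne (0 : M)
  apply hm
  rw [← D.act_proj m, h0]
  simp

end HopfModuleData

end HopfModule

/-! ### Existence and uniqueness of integrals -/

section Integrals

open Coalgebra HopfAlgebra WithConv LinearMap

variable {k H : Type*} [Field k] [Ring H] [HopfAlgebra k H]

/-- The map `h ↦ h₁ f(h₂)`. -/
noncomputable def rightHit (f : Module.Dual k H) : H →ₗ[k] H :=
  (TensorProduct.rid k H).toLinearMap ∘ₗ f.lTensor H ∘ₗ comul

/-- The reason is Δ(S(x₁)) (x₂ ⊗ 1) = 1 ⊗ S(x). This is the compatibility of action and coaction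
that makes H* a Hopf module. -/
theorem rightHit_antipode (f : Module.Dual k H) (h x : H) :
    mul' k H (TensorProduct.map (rightHit f ∘ₗ mulLeft k h ∘ₗ antipode k) LinearMap.id
      (comul (R := k) x)) = rightHit (f ∘ₗ mulRight k (antipode k x)) h := by
  let L : H ⊗[k] H →ₗ[k] H := (TensorProduct.rid k H).toLinearMap ∘ₗ f.lTensor H
  have hL (u : H ⊗[k] H) (y : H) : L (u * y ⊗ₜ 1) = L u * y := by
    induction u with
    | zero => simp
    | add u v hu hv => simp only [map_add, add_mul, hu, hv]
    | tmul a b => simp [L]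
  have h1 (u : H ⊗[k] H) :
      mul' k H (TensorProduct.map (rightHit f ∘ₗ mulLeft k h ∘ₗ antipode k) LinearMap.id u) =
        L (comul h * mul' k (H ⊗[k] H) (TensorProduct.map (comul ∘ₗ antipode k)
          (Algebra.TensorProduct.includeLeft : H →ₐ[k] H ⊗[k] H).toLinearMap u)) := by
    induction u with
    | zero => simp
    | add u v hu hv => simp only [map_add, mul_add, hu, hv]
    | tmul a b =>
      simp only [TensorProduct.map_tmul, mul'_apply, AlgHom.toLinearMap_apply,
        Algebra.TensorProduct.includeLeft_apply, ← mul_assoc, hL]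
      simp [rightHit, L]
  have h2 : mul' k (H ⊗[k] H) (TensorProduct.map (comul ∘ₗ antipode k)
      (Algebra.TensorProduct.includeLeft : H →ₐ[k] H ⊗[k] H).toLinearMap (comul x)) =
        1 ⊗ₜ antipode k x :=
    congrArg (fun F : WithConv (H →ₗ[k] H ⊗[k] H) => F.ofConv x)
      (comul_antipode_mul_includeLeft (k := k) (H := H))
  rw [h1, h2]
  simp only [rightHit, comp_apply, L]
  generalize comul (R := k) h = u
  induction u with
  | zero => simp
  | add u v hu hv => simp only [map_add, add_mul, hu, hv]
  | tmul a b => simp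

/-- A left integral of the dual algebra: `h₁ t(h₂) = t(h) 1`. -/
def IsLeftIntegral (t : Module.Dual k H) : Prop := ∀ h, rightHit t h = t h • 1

theorem apply_rightHit (a f : Module.Dual k H) (h : H) :
    a (rightHit f h) = (toConv a * toConv f) h := by
  rw [(ℛ k h).convMul_apply]
  conv_lhs => rw [rightHit, comp_apply, comp_apply, ← (ℛ k h).eq]
  simp [mul_comm]

theorem isLeftIntegral_iff {t : WithConv (H →ₗ[k] k)} :
    IsLeftIntegral t.ofConv ↔ ∀ a : WithConv (H →ₗ[k] k), a * t = a 1 • t := by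
  constructor
  · intro ht a
    ext h
    have := apply_rightHit a.ofConv t.ofConv h
    rw [ht h, map_smul, smul_eq_mul, mul_comm] at this
    exact this.symm
  · intro h x
    rw [← sub_eq_zero, ← Module.forall_dual_apply_eq_zero_iff k]
    intro a
    have h1 := congrArg (fun F : WithConv (H →ₗ[k] k) => F.ofConv x) (h (toConv a))
    rw [map_sub, apply_rightHit, map_smul, sub_eq_zero, smul_eq_mul, mul_comm]
    exact h1

theorem counit_rightHit (f : Module.Dual k H) (h : H) : counit (R := k) (rightHit f h) = f h := by
  rw [apply_rightHit]
  exact congrArg (fun F : WithConv (H →ₗ[k] k) => F.ofConv h) (one_mul (toConv f))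

theorem lTensor_rightHit_comul (f : Module.Dual k H) (h : H) :
    (rightHit f).lTensor H (comul (R := k) h) = comul (R := k) (rightHit f h) := by
  have h1 (w : H ⊗[k] H) :
      ((TensorProduct.rid k H).toLinearMap ∘ₗ f.lTensor H).lTensor H
        (TensorProduct.assoc k H H H ((comul (R := k)).rTensor H w)) =
      comul (R := k) (TensorProduct.rid k H (f.lTensor H w)) := by
    induction w with
    | zero => simp
    | add u v hu hv => simp only [map_add, hu, hv]
    | tmul a b =>
      simp only [rTensor_tmul, lTensor_tmul, TensorProduct.rid_tmul, map_smul]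
      generalize comul (R := k) a = z
      induction z with
      | zero => simp
      | add u v hu hv => simp only [map_add, TensorProduct.add_tmul, smul_add, hu, hv]
      | tmul p q => simp
  have h2 := h1 (comul h)
  rw [coassoc_apply, ← lTensor_comp_apply] at h2
  exact h2

/-- The right coaction on the dual, dual to left multiplication. -/
noncomputable def dualCoact [Module.Finite k H] : Module.Dual k H →ₗ[k] Module.Dual k H ⊗[k] H where
  toFun f := (dualTensorHomEquiv k H H).symm (rightHit f)
  map_add' f g := by
    rw [← map_add]; congr 1; ext; simp [rightHit, LinearMap.lTensor_add]
  map_smul' c f := by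
    rw [← map_smul]; congr 1; ext; simp [rightHit, LinearMap.lTensor_smul]

theorem dualTensorHom_dualCoact [Module.Finite k H] (f : Module.Dual k H) :
    dualTensorHom k H H (dualCoact f) = rightHit f :=
  (dualTensorHomEquiv k H H).apply_symm_apply _

variable (k H) in
/-- The right Hopf module structure on the dual of a finite-dimensional Hopf algebra. -/
noncomputable def dualHopfModule [Module.Finite k H] :
    HopfModuleData k H (Module.Dual k H) where
  coact := dualCoact
  -- Translating the argument by right multiplication is a left action on H*; the antipode turns it
  -- into a right one. The coinvariants of `dualCoact` are the left integrals.
  act := TensorProduct.lift (LinearMap.mk₂ k (fun f x => f ∘ₗ mulRight k (antipode k x))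
    (fun f g x => rfl) (fun c f x => rfl) (fun f x y => by ext; simp [mul_add])
    (fun c f x => by ext; simp))
  coact_counit f := by
    have h1 (u : Module.Dual k H ⊗[k] H) : TensorProduct.rid k _ (counit.lTensor _ u) =
        counit ∘ₗ dualTensorHom k H H u := by
      induction u with
      | zero => simp
      | add u v hu hv => simp only [map_add, LinearMap.comp_add, hu, hv]
      | tmul g y => ext h; simp [mul_comm]
    rw [h1, dualTensorHom_dualCoact]
    ext h
    exact counit_rightHit f h
  coact_coassoc f := by
    apply (dualTensorHom_bijective (R := k) (M := H) (N := H ⊗[k] H)).1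
    ext h
    have h1 (u : Module.Dual k H ⊗[k] H) :
        dualTensorHom k H (H ⊗[k] H) (TensorProduct.assoc k _ H H (dualCoact.rTensor H u)) h =
          (dualTensorHom k H H u).lTensor H (comul h) := by
      induction u with
      | zero => simp
      | add u v hu hv => simp only [map_add, LinearMap.add_apply, LinearMap.lTensor_add, hu, hv]
      | tmul g y =>
        have h3 (w : Module.Dual k H ⊗[k] H) :
            dualTensorHom k H (H ⊗[k] H) (TensorProduct.assoc k _ H H (w ⊗ₜ y)) h =
              dualTensorHom k H H w h ⊗ₜ y := by
          induction w with
          | zero => simp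
          | add u v hu hv =>
            simp only [map_add, LinearMap.add_apply, TensorProduct.add_tmul, hu, hv]
          | tmul a b => simp [TensorProduct.smul_tmul']
        rw [rTensor_tmul, h3, dualTensorHom_dualCoact]
        simp only [rightHit, comp_apply]
        generalize comul (R := k) h = z
        induction z with
        | zero => simp
        | add u v hu hv => simp only [map_add, TensorProduct.add_tmul, hu, hv]
        | tmul a b => simp [TensorProduct.smul_tmul]
    have h2 (u : Module.Dual k H ⊗[k] H) :
        dualTensorHom k H (H ⊗[k] H) (comul.lTensor _ u) h =
          comul (R := k) (dualTensorHom k H H u h) := by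
      induction u with
      | zero => simp
      | add u v hu hv => simp only [map_add, LinearMap.add_apply, hu, hv]
      | tmul g y => simp
    rw [h1, h2, dualTensorHom_dualCoact, lTensor_rightHit_comul]
  act_one m := by ext; simp
  act_mul m x y := by ext; simp [antipode_mul_antidistrib, mul_assoc]
  coact_act f x := by
    apply (dualTensorHom_bijective (R := k) (M := H) (N := H)).1
    rw [dualTensorHom_dualCoact]
    ext h
    rw [TensorProduct.lift.tmul, LinearMap.mk₂_apply, ← rightHit_antipode,
      ← dualTensorHom_dualCoact]
    generalize dualCoact f = u
    generalize comul (R := k) x = v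
    induction u with
    | zero => simp
    | add u u' hu hu' =>
      simp only [map_add, TensorProduct.add_tmul, LinearMap.add_apply, LinearMap.add_comp,
        TensorProduct.map_add_left, hu, hu']
    | tmul g y =>
      induction v with
      | zero => simp
      | add u v hu hv => simp only [map_add, TensorProduct.tmul_add, LinearMap.add_apply, hu, hv]
      | tmul a b => simp

variable (k H) in
/-- A finite-dimensional Hopf algebra has a nonzero left integral on it. -/
theorem exists_isLeftIntegral [Module.Finite k H] [Nontrivial H] :
    ∃ t : Module.Dual k H, t ≠ 0 ∧ IsLeftIntegral t := by
  obtain ⟨t, ht, h⟩ := (dualHopfModule k H).exists_ne_zero_coact_eq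
  refine ⟨t, ht, fun x => ?_⟩
  rw [← dualTensorHom_dualCoact]
  change dualCoact t = _ at h
  rw [h, dualTensorHom_apply]

/-- Since t is coinvariant, its orbit map T is a map of comodules: T(x₁) ⊗ x₂ is the coaction of
T(x). -/
theorem IsLeftIntegral.dualTensorHom_rTensor {t : Module.Dual k H} (ht : IsLeftIntegral t)
    {T : H →ₗ[k] Module.Dual k H} (hT : ∀ x h, T x h = t (h * antipode k x)) (x : H) :
    dualTensorHom k H H (T.rTensor H (comul x)) = rightHit (T x) := by
  ext h
  have h1 : T x = t ∘ₗ mulRight k (antipode k x) := by ext h; simp [hT]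
  rw [h1, ← rightHit_antipode]
  generalize comul (R := k) x = w
  induction w with
  | zero => simp
  | add u v hu hv => simp only [map_add, LinearMap.add_apply, hu, hv]
  | tmul a b => simp [hT, ht _]

theorem counit_rid_lTensor_comul (a : Module.Dual k H) (x : H) :
    counit (R := k) (TensorProduct.rid k H (a.lTensor H (comul x))) = a x :=
  counit_rightHit a x

/-- A nonzero left integral generates the dual as a right module. -/
theorem IsLeftIntegral.injective [Module.Finite k H] {t : Module.Dual k H}
    (ht : IsLeftIntegral t) (h0 : t ≠ 0) {T : H →ₗ[k] Module.Dual k H}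
    (hT : ∀ x h, T x h = t (h * antipode k x)) : Function.Injective T := by
  rw [← LinearMap.ker_eq_bot, Submodule.eq_bot_iff]
  have hx0 {x : H} (hx : T x = 0) : T.rTensor H (comul x) = 0 := by
    apply (dualTensorHom_bijective (R := k) (M := H) (N := H)).1
    rw [ht.dualTensorHom_rTensor hT, hx, map_zero]
    ext; simp [rightHit]
  -- Acting on T(x₁) ⊗ x₂ = 0 with S(x₂) gives T(x₁ S(x₂)) = ε(x) t.
  have hε {x : H} (hx : T x = 0) : counit (R := k) x = 0 := by
    let V : Module.Dual k H ⊗[k] H →ₗ[k] Module.Dual k H :=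
      (dualHopfModule k H).act ∘ₗ (antipode k).lTensor _
    have h1 (w : H ⊗[k] H) : V (T.rTensor H w) = T (mul' k H ((antipode k).lTensor H w)) := by
      induction w with
      | zero => simp
      | add u v hu hv => simp only [map_add, hu, hv]
      | tmul a b =>
        ext h
        simp [V, dualHopfModule, hT, antipode_mul_antidistrib, mul_assoc]
    have h2 := h1 (comul x)
    rw [hx0 hx, map_zero, mul_antipode_lTensor_comul_apply] at h2
    by_contra hne
    apply h0
    ext h
    have h3 := congrArg (fun f : Module.Dual k H => f h) h2
    simpa [hT, Algebra.algebraMap_eq_smul_one, hne] using h3.symm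
  intro x hx
  rw [← Module.forall_dual_apply_eq_zero_iff k]
  intro a
  -- The kernel of T is stable under x ↦ x₁ a(x₂), whose counit is a(x).
  rw [← counit_rid_lTensor_comul]
  apply hε
  have h1 (w : H ⊗[k] H) : T (TensorProduct.rid k H (a.lTensor H w)) =
      TensorProduct.rid k _ (a.lTensor _ (T.rTensor H w)) := by
    induction w with
    | zero => simp
    | add u v hu hv => simp only [map_add, hu, hv]
    | tmul a b => simp
  rw [h1, hx0 hx, map_zero, map_zero]

/-- The left integrals on a finite-dimensional Hopf algebra are unique up to scalars. -/
theorem IsLeftIntegral.exists_smul_eq [Module.Finite k H] {t t' : Module.Dual k H}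
    (ht : IsLeftIntegral t) (ht' : IsLeftIntegral t') (h0 : t ≠ 0) : ∃ c : k, t' = c • t := by
  let T : H →ₗ[k] Module.Dual k H := LinearMap.mk₂ k (fun x h => t (h * antipode k x))
    (by intros; simp [mul_add]) (by intros; simp) (by intros; simp [add_mul]) (by intros; simp)
  have hT (x h) : T x h = t (h * antipode k x) := rfl
  have hinj := ht.injective h0 hT
  obtain ⟨x, rfl⟩ :=
    (LinearMap.injective_iff_surjective_of_finrank_eq_finrank Subspace.dual_finrank_eq.symm).1
      hinj t'
  have h1 : T.rTensor H (comul x) = T x ⊗ₜ 1 := by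
    apply (dualTensorHom_bijective (R := k) (M := H) (N := H)).1
    rw [ht.dualTensorHom_rTensor hT]
    ext h
    rw [ht' h, dualTensorHom_apply]
  -- T is injective and colinear, so coinvariance of T(x) forces Δ(x) = x ⊗ 1, hence x is a scalar.
  have h2 : x = counit (R := k) x • 1 := by
    rw [← sub_eq_zero, ← Module.forall_dual_apply_eq_zero_iff k]
    intro a
    have h3 (w : H ⊗[k] H) : T (TensorProduct.rid k H (a.lTensor H w)) =
        TensorProduct.rid k _ (a.lTensor _ (T.rTensor H w)) := by
      induction w with
      | zero => simp
      | add u v hu hv => simp only [map_add, hu, hv]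
      | tmul a b => simp
    have h4 : TensorProduct.rid k H (a.lTensor H (comul x)) = a 1 • x :=
      hinj (by rw [h3, h1]; simp)
    rw [map_sub, ← counit_rid_lTensor_comul, h4]
    simp [mul_comm]
  refine ⟨counit (R := k) x, ?_⟩
  ext h
  rw [hT, h2]
  simp

end Integrals

/-! ### Orthogonality between subspaces of H and of the dual algebra -/

section Annihilators

open Coalgebra WithConv LinearMap

theorem TensorProduct.eq_zero_of_forall_dual {k V W : Type*} [Field k] [AddCommGroup V] [Module k V]
    [AddCommGroup W] [Module k W] [Module.Finite k V] [Module.Finite k W] (w : V ⊗[k] W)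
    (h : ∀ (f : Module.Dual k V) (g : Module.Dual k W), mul' k k (TensorProduct.map f g w) = 0) :
    w = 0 := by
  rw [← Module.forall_dual_apply_eq_zero_iff k]
  intro F
  obtain ⟨u, rfl⟩ := (TensorProduct.dualDistribEquiv k V W).surjective F
  change TensorProduct.dualDistrib k V W u w = 0
  induction u with
  | zero => simp
  | add u v hu hv => simp only [map_add, LinearMap.add_apply, hu, hv, add_zero]
  | tmul f g =>
    rw [← h f g]
    clear h
    induction w with
    | zero => simp
    | add u v hu hv => simp only [map_add, hu, hv]
    | tmul a b => simp

variable {k H : Type*} [Field k] [AddCommGroup H] [Module k H]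

/-- The functionals vanishing on a subspace. -/
def annih (D : Submodule k H) : Submodule k (WithConv (H →ₗ[k] k)) :=
  D.dualAnnihilator.comap (WithConv.linearEquiv k (H →ₗ[k] k)).toLinearMap

/-- The common zeros of a subspace of functionals. -/
def coannih (S : Submodule k (WithConv (H →ₗ[k] k))) : Submodule k H :=
  (S.map (WithConv.linearEquiv k (H →ₗ[k] k)).toLinearMap :
    Submodule k (Module.Dual k H)).dualCoannihilator

theorem mem_annih {D : Submodule k H} {a : WithConv (H →ₗ[k] k)} :
    a ∈ annih D ↔ ∀ x ∈ D, a x = 0 :=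
  Submodule.mem_dualAnnihilator _

theorem mem_coannih {S : Submodule k (WithConv (H →ₗ[k] k))} {x : H} :
    x ∈ coannih S ↔ ∀ a ∈ S, a x = 0 := by
  simp only [coannih, Submodule.mem_dualCoannihilator, Submodule.mem_map]
  exact ⟨fun h a ha => h _ ⟨a, ha, rfl⟩, fun h φ ⟨a, ha, e⟩ => e ▸ h a ha⟩

theorem coannih_annih (D : Submodule k H) : coannih (annih D) = D := by
  rw [coannih, annih, Submodule.map_comap_eq_of_surjective (LinearEquiv.surjective _)]
  exact Subspace.dualAnnihilator_dualCoannihilator_eq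

theorem annih_coannih [Module.Finite k H] (S : Submodule k (WithConv (H →ₗ[k] k))) :
    annih (coannih S) = S := by
  rw [coannih, annih, Subspace.dualCoannihilator_dualAnnihilator_eq,
    Submodule.comap_map_eq_of_injective (LinearEquiv.injective _)]

theorem finrank_add_finrank_coannih [Module.Finite k H] (S : Submodule k (WithConv (H →ₗ[k] k))) :
    Module.finrank k S + Module.finrank k (coannih S) = Module.finrank k H := by
  rw [← Subspace.finrank_add_finrank_dualCoannihilator_eq
    (S.map (WithConv.linearEquiv k (H →ₗ[k] k)).toLinearMap : Submodule k (Module.Dual k H)),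
    coannih]
  congr 1
  exact ((WithConv.linearEquiv k (H →ₗ[k] k)).finrank_map_eq S).symm

theorem finrank_withConv_dual : Module.finrank k (WithConv (H →ₗ[k] k)) = Module.finrank k H :=
  ((WithConv.linearEquiv k (H →ₗ[k] k)).finrank_eq).trans Subspace.dual_finrank_eq

instance [Module.Finite k H] : Module.Finite k (WithConv (H →ₗ[k] k)) :=
  Module.Finite.equiv (WithConv.linearEquiv k (H →ₗ[k] k)).symm

end Annihilators

/-! ### The dual Maschke theorem -/

section Semisimple

open Coalgebra HopfAlgebra WithConv LinearMap

variable {k H : Type*} [Field k] [Ring H] [HopfAlgebra k H]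

/-- Invariance of the integral: j(x₁) t(x₂ S(y)) = t(x S(y₁)) j(y₂), from `rightHit_antipode` and
`ht`. -/
theorem conv_mulRight_antipode {t : Module.Dual k H} (ht : IsLeftIntegral t)
    (j : WithConv (H →ₗ[k] k)) (x y : H) :
    (j * toConv (t ∘ₗ mulRight k (antipode k y))) x =
      t (x * antipode k (rightHit j.ofConv y)) := by
  rw [← toConv_ofConv j, ← apply_rightHit, ← rightHit_antipode]
  have h1 (w : H ⊗[k] H) : j.ofConv (mul' k H
      (TensorProduct.map (rightHit t ∘ₗ mulLeft k x ∘ₗ antipode k) LinearMap.id w)) =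
      t (x * antipode k (TensorProduct.rid k H (j.ofConv.lTensor H w))) := by
    induction w with
    | zero => simp
    | add u v hu hv => simp only [map_add, mul_add, hu, hv]
    | tmul a b => simp [ht _, mul_comm]
  exact h1 _

/-- Dual Maschke theorem: if there is a normalised left integral, then a subspace whose annihilator
is a nil ideal of the dual algebra is everything. -/
theorem IsLeftIntegral.eq_top [Module.Finite k H] {t : Module.Dual k H} (ht : IsLeftIntegral t)
    (h1 : t 1 = 1) {D : Submodule k H}
    (hD : ∀ (a j : WithConv (H →ₗ[k] k)), j ∈ annih D → a * j ∈ annih D)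
    (hnil : ∀ j ∈ annih D, IsNilpotent j) : D = ⊤ := by
  obtain ⟨g, hg⟩ := D.mkQ.exists_rightInverse_of_surjective
    (LinearMap.range_eq_top.2 D.mkQ_surjective)
  -- With g a linear section of H → H/D, the functional j₀(x) = t(x₁ S(g(x̄₂))) will be a right
  -- identity of the annihilator of D. It vanishes on D because Δ(D) ⊆ H ⊗ D.
  let G : H ⊗[k] H →ₗ[k] k := t ∘ₗ mul' k H ∘ₗ (antipode k ∘ₗ g ∘ₗ D.mkQ).lTensor H
  let j₀ : WithConv (H →ₗ[k] k) := toConv (G ∘ₗ comul)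
  have hj₀ : j₀ ∈ annih D := by
    rw [mem_annih]
    intro x hx
    have h2 : D.mkQ.lTensor H (comul (R := k) x) = 0 := by
      apply TensorProduct.eq_zero_of_forall_dual
      intro a b
      have h3 : toConv (b ∘ₗ D.mkQ) ∈ annih D := by
        rw [mem_annih]
        intro y hy
        change b (D.mkQ y) = 0
        rw [Submodule.mkQ_apply, (Submodule.Quotient.mk_eq_zero D).2 hy, map_zero]
      have h4 := mem_annih.1 (hD (toConv a) _ h3) x hx
      rw [← LinearMap.comp_apply (TensorProduct.map a b), LinearMap.map_comp_lTensor]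
      exact h4
    change t (mul' k H ((antipode k ∘ₗ g ∘ₗ D.mkQ).lTensor H (comul x))) = 0
    rw [← LinearMap.comp_assoc, lTensor_comp_apply, h2]
    simp
  -- Invariance moves j inside: t(x₁ S(x₂)) j(x₃) = t(1) j(x) = j(x). The section disappears because
  -- `rightHit j` vanishes on D.
  have hmul : ∀ j ∈ annih D, j * j₀ = j := by
    intro j hj
    have hker : ∀ y ∈ D, rightHit j.ofConv y = 0 := by
      intro y hy
      rw [← Module.forall_dual_apply_eq_zero_iff k]
      intro a
      rw [apply_rightHit]
      exact mem_annih.1 (hD (toConv a) j hj) y hy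
    have hp (y : H) : rightHit j.ofConv (g (D.mkQ y)) = rightHit j.ofConv y := by
      rw [← sub_eq_zero, ← map_sub]
      apply hker
      rw [← Submodule.Quotient.mk_eq_zero, ← Submodule.mkQ_apply, map_sub]
      have := LinearMap.congr_fun hg (D.mkQ y)
      rw [LinearMap.comp_apply, LinearMap.id_apply] at this
      rw [this, sub_self]
    ext x
    have e1 (w : H ⊗[k] H) : mul' k k (TensorProduct.map j.ofConv G
        (TensorProduct.assoc k H H H (comul.rTensor H w))) =
        t (mul' k H ((antipode k ∘ₗ rightHit j.ofConv).lTensor H w)) := by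
      induction w with
      | zero => simp
      | add u v hu hv => simp only [map_add, hu, hv]
      | tmul a b =>
        rw [lTensor_tmul, mul'_apply, LinearMap.comp_apply, ← hp, ← conv_mulRight_antipode ht,
          convMul_apply, rTensor_tmul]
        generalize comul (R := k) a = z
        induction z with
        | zero => simp
        | add u v hu hv => simp only [map_add, TensorProduct.add_tmul, hu, hv]
        | tmul p q => simp [G]
    have e2 : (j * j₀) x = mul' k k (TensorProduct.map j.ofConv G
        (TensorProduct.assoc k H H H (comul.rTensor H (comul x)))) := by
      rw [coassoc_apply, ← LinearMap.comp_apply (TensorProduct.map _ _),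
        LinearMap.map_comp_lTensor]
      rfl
    change (j * j₀) x = j x
    rw [e2, e1, lTensor_comp_apply, lTensor_rightHit_comul, mul_antipode_lTensor_comul_apply,
      counit_rightHit, Algebra.algebraMap_eq_smul_one, map_smul, h1, smul_eq_mul, mul_one]
  -- A nilpotent right identity forces the ideal to be zero.
  obtain ⟨n, hn⟩ := hnil _ hj₀
  have hzero : annih D = ⊥ := by
    rw [Submodule.eq_bot_iff]
    intro j hj
    have h2 (m : ℕ) : j * j₀ ^ m = j := by
      induction m with
      | zero => simp
      | succ m ih => rw [pow_succ, ← mul_assoc, ih, hmul j hj]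
    rw [← h2 n, hn, mul_zero]
  rw [← coannih_annih D, hzero, eq_top_iff]
  intro x _
  rw [mem_coannih]
  intro a ha
  rw [(Submodule.mem_bot k).1 ha]
  rfl

end Semisimple

/-! ### Subcoalgebras, wedges and the radical of the dual algebra -/

section Duality

open Coalgebra WithConv LinearMap

variable {k C : Type*} [Field k] [AddCommGroup C] [Module k C]

/-- With P a linear retraction onto D, any functional differs from its composite with P by one
vanishing on D. Hence w and (P ⊗ P)w pair equally with all f ⊗ g. -/
theorem TensorProduct.mem_range_map_subtype [Module.Finite k C] {D : Submodule k C} {w : C ⊗[k] C}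
    (hl : ∀ f g : Module.Dual k C, (∀ x ∈ D, f x = 0) → mul' k k (TensorProduct.map f g w) = 0)
    (hr : ∀ f g : Module.Dual k C, (∀ x ∈ D, g x = 0) → mul' k k (TensorProduct.map f g w) = 0) :
    w ∈ LinearMap.range (TensorProduct.map D.subtype D.subtype) := by
  obtain ⟨P, hP⟩ := D.subtype.exists_leftInverse_of_injective D.ker_subtype
  refine ⟨TensorProduct.map P P w, ?_⟩
  rw [← LinearMap.comp_apply, ← TensorProduct.map_comp, eq_comm, ← sub_eq_zero]
  have hsub (f : Module.Dual k C) : ∀ x ∈ D, (f - f ∘ₗ D.subtype ∘ₗ P) x = 0 := by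
    intro x hx
    have h1 : P x = ⟨x, hx⟩ := LinearMap.congr_fun hP ⟨x, hx⟩
    simp [h1]
  apply TensorProduct.eq_zero_of_forall_dual
  intro f g
  have h1 := hl _ g (hsub f)
  have h2 := hr (f ∘ₗ D.subtype ∘ₗ P) _ (hsub g)
  have h3 : TensorProduct.map f g =
      TensorProduct.map (f - f ∘ₗ D.subtype ∘ₗ P) g +
        (TensorProduct.map (f ∘ₗ D.subtype ∘ₗ P) (g - g ∘ₗ D.subtype ∘ₗ P) +
          TensorProduct.map (f ∘ₗ D.subtype ∘ₗ P) (g ∘ₗ D.subtype ∘ₗ P)) := by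
    rw [← TensorProduct.map_add_right, sub_add_cancel, ← TensorProduct.map_add_left, sub_add_cancel]
  rw [map_sub, map_sub, ← LinearMap.comp_apply (TensorProduct.map f g), ← TensorProduct.map_comp,
    h3, LinearMap.add_apply, LinearMap.add_apply, map_add, map_add, h1, h2, zero_add, zero_add]
  exact sub_self _

variable [Coalgebra k C]

theorem IsSubcoalgebra.mul_apply_eq_zero {D : Submodule k C} (hD : IsSubcoalgebra k D)
    {a b : WithConv (C →ₗ[k] k)} (h : a ∈ annih D ∨ b ∈ annih D) {x : C} (hx : x ∈ D) :
    (a * b) x = 0 := by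
  obtain ⟨w, hw⟩ := hD x hx
  rw [convMul_apply, ← hw, ← LinearMap.comp_apply (TensorProduct.map _ _), ← TensorProduct.map_comp]
  rcases h with h | h
  · have : a.ofConv ∘ₗ D.subtype = 0 := by ext y; exact mem_annih.1 h y y.2
    simp [this]
  · have : b.ofConv ∘ₗ D.subtype = 0 := by ext y; exact mem_annih.1 h y y.2
    simp [this]

theorem isSubcoalgebra_coannih [Module.Finite k C] {I : Submodule k (WithConv (C →ₗ[k] k))}
    (hl : ∀ a, ∀ x ∈ I, a * x ∈ I) (hr : ∀ a, ∀ x ∈ I, x * a ∈ I) :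
    IsSubcoalgebra k (coannih I) := by
  intro x hx
  apply TensorProduct.mem_range_map_subtype
  · intro f g hf
    have h1 : toConv f ∈ I := by rw [← annih_coannih I, mem_annih]; exact hf
    exact mem_coannih.1 hx _ (hr (toConv g) _ h1)
  · intro f g hg
    have h1 : toConv g ∈ I := by rw [← annih_coannih I, mem_annih]; exact hg
    exact mem_coannih.1 hx _ (hl (toConv f) _ h1)

/-- The wedge of two subspaces is dual to the product in the dual algebra. -/
theorem wedge_eq_coannih [Module.Finite k C] (X Y : Submodule k C) :
    wedge k X Y = coannih (annih X * annih Y) := by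
  have hker : LinearMap.range (X.subtype.rTensor C) ⊔ LinearMap.range (Y.subtype.lTensor C) =
      LinearMap.ker (TensorProduct.map X.mkQ Y.mkQ) := by
    rw [TensorProduct.map_ker (LinearMap.exact_subtype_mkQ X) X.mkQ_surjective
      (LinearMap.exact_subtype_mkQ Y) Y.mkQ_surjective, sup_comm]
  ext x
  rw [wedge, Submodule.mem_comap, hker, LinearMap.mem_ker, mem_coannih]
  constructor
  · intro h a ha
    induction ha using Submodule.mul_induction_on' with
    | mem_mul_mem a ha b hb =>
      have h1 : a.ofConv = X.liftQ a.ofConv (fun x hx => mem_annih.1 ha x hx) ∘ₗ X.mkQ :=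
        (Submodule.liftQ_mkQ _ _ _).symm
      have h2 : b.ofConv = Y.liftQ b.ofConv (fun x hx => mem_annih.1 hb x hx) ∘ₗ Y.mkQ :=
        (Submodule.liftQ_mkQ _ _ _).symm
      rw [convMul_apply, h1, h2, TensorProduct.map_comp, LinearMap.comp_apply, h,
        map_zero, map_zero]
    | add a _ b _ ha hb => rw [ofConv_add, LinearMap.add_apply, ha, hb, add_zero]
  · intro h
    apply TensorProduct.eq_zero_of_forall_dual
    intro f g
    rw [← LinearMap.comp_apply (TensorProduct.map f g), ← TensorProduct.map_comp]
    refine h (toConv (f ∘ₗ X.mkQ) * toConv (g ∘ₗ Y.mkQ)) (Submodule.mul_mem_mul ?_ ?_)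
    · rw [mem_annih]
      intro y hy
      change f (X.mkQ y) = 0
      rw [Submodule.mkQ_apply, (Submodule.Quotient.mk_eq_zero X).2 hy, map_zero]
    · rw [mem_annih]
      intro y hy
      change g (Y.mkQ y) = 0
      rw [Submodule.mkQ_apply, (Submodule.Quotient.mk_eq_zero Y).2 hy, map_zero]

theorem coradicalFiltration_one_eq [Module.Finite k C] :
    coradicalFiltration k C 1 =
      coannih (annih (coradical k C) * annih (coradical k C)) :=
  wedge_eq_coannih _ _

/-- The zeros of the kernel of a map from the dual algebra onto a simple algebra form a simple
subcoalgebra. -/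
theorem isSimpleSubcoalgebra_coannih_ker [Module.Finite k C] {B : Type*} [Ring B] [Algebra k B]
    [IsSimpleRing B] (p : WithConv (C →ₗ[k] k) →ₐ[k] B) (hp : Function.Surjective p) :
    IsSimpleSubcoalgebra k (coannih (LinearMap.ker p.toLinearMap)) where
  isSubcoalgebra := isSubcoalgebra_coannih (fun a x hx => by simp_all) (fun a x hx => by simp_all)
  ne_bot h := by
    have h1 := annih_coannih (LinearMap.ker p.toLinearMap)
    rw [h] at h1
    have h2 : (1 : WithConv (C →ₗ[k] k)) ∈ LinearMap.ker p.toLinearMap := by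
      rw [← h1, mem_annih]
      intro x hx
      rw [(Submodule.mem_bot k).1 hx, map_zero]
    simp at h2
  eq_bot_or_eq E hE hle := by
    by_cases hEp : annih E ≤ LinearMap.ker p.toLinearMap
    · right
      apply le_antisymm hle
      intro x hx
      rw [← coannih_annih E, mem_coannih]
      exact fun a ha => mem_coannih.1 hx a (hEp ha)
    · left
      obtain ⟨a, ha, hpa⟩ := SetLike.not_le_iff_exists.1 hEp
      -- The annihilator of a subcoalgebra is a two-sided ideal. Its nonzero image in the simple
      -- ring B contains 1, and it contains the kernel of p, so it contains 1 and E = 0.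
      let I : TwoSidedIdeal B := TwoSidedIdeal.mk' (p '' annih E)
        ⟨0, zero_mem _, map_zero p⟩
        (by rintro _ _ ⟨a, ha, rfl⟩ ⟨b, hb, rfl⟩; exact ⟨a + b, add_mem ha hb, map_add p a b⟩)
        (by rintro _ ⟨a, ha, rfl⟩; exact ⟨-a, neg_mem ha, map_neg p a⟩)
        (by
          rintro x _ ⟨b, hb, rfl⟩
          obtain ⟨a, rfl⟩ := hp x
          exact ⟨a * b, mem_annih.2 fun x hx => hE.mul_apply_eq_zero (.inr hb) hx, map_mul p a b⟩)
        (by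
          rintro _ x ⟨b, hb, rfl⟩
          obtain ⟨a, rfl⟩ := hp x
          exact ⟨b * a, mem_annih.2 fun x hx => hE.mul_apply_eq_zero (.inl hb) hx, map_mul p b a⟩)
      have hI {b : B} : b ∈ I ↔ b ∈ p '' annih E := TwoSidedIdeal.mem_mk' ..
      have h1 : (1 : B) ∈ I :=
        IsSimpleRing.one_mem_of_ne_zero_mem I (x := p a) hpa (hI.2 ⟨a, ha, rfl⟩)
      obtain ⟨u, hu, hu1⟩ := hI.1 h1
      have h2 : u - 1 ∈ annih E := by
        have : u - 1 ∈ LinearMap.ker p.toLinearMap := by simp [hu1]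
        rw [← annih_coannih (LinearMap.ker p.toLinearMap)] at this
        exact mem_annih.2 fun x hx => mem_annih.1 this x (hle hx)
      have h3 : (1 : WithConv (C →ₗ[k] k)) ∈ annih E := by
        simpa using sub_mem hu h2
      rw [Submodule.eq_bot_iff]
      intro x hx
      rw [← coannih_annih E, mem_coannih] at hx
      rw [← Module.forall_dual_apply_eq_zero_iff k]
      intro f
      refine hx (toConv f) (mem_annih.2 fun y hy => ?_)
      have := hE.mul_apply_eq_zero (a := toConv f) (.inr h3) hy
      rwa [mul_one] at this

theorem annih_coradical_le_ker [Module.Finite k C] {B : Type*} [Ring B] [Algebra k B]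
    [IsSimpleRing B] (p : WithConv (C →ₗ[k] k) →ₐ[k] B) (hp : Function.Surjective p) :
    annih (coradical k C) ≤ LinearMap.ker p.toLinearMap := by
  rw [← annih_coannih (LinearMap.ker p.toLinearMap)]
  intro a ha
  have h1 : coannih (LinearMap.ker p.toLinearMap) ≤ coradical k C :=
    le_sSup (isSimpleSubcoalgebra_coannih_ker p hp)
  exact mem_annih.2 fun x hx => mem_annih.1 ha x (h1 hx)

/-- The quotient by the Jacobson radical is a product of matrix algebras over k. The kernel of each
projection to a factor contains the annihilator of the coradical, and these kernels meet in the
Jacobson radical. -/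
theorem annih_coradical_le_jacobson [IsAlgClosed k] [Module.Finite k C]
    {a : WithConv (C →ₗ[k] k)} (ha : a ∈ annih (coradical k C)) :
    a ∈ Ring.jacobson (WithConv (C →ₗ[k] k)) := by
  have := IsArtinianRing.of_finite k (WithConv (C →ₗ[k] k))
  obtain ⟨n, d, hd, ⟨e⟩⟩ := IsSemisimpleRing.exists_algEquiv_pi_matrix_of_isAlgClosed k
    (WithConv (C →ₗ[k] k) ⧸ Ring.jacobson (WithConv (C →ₗ[k] k)))
  rw [← Ideal.Quotient.eq_zero_iff_mem, ← map_eq_zero_iff e e.injective]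
  ext i : 1
  let p : WithConv (C →ₗ[k] k) →ₐ[k] Matrix (Fin (d i)) (Fin (d i)) k :=
    (Pi.evalAlgHom k (fun i => Matrix (Fin (d i)) (Fin (d i)) k) i).comp
      (e.toAlgHom.comp (Ideal.Quotient.mkₐ k _))
  have hp : Function.Surjective p := by
    intro b
    obtain ⟨c, hc⟩ := e.surjective (Pi.single i b)
    obtain ⟨u, rfl⟩ := Ideal.Quotient.mk_surjective c
    refine ⟨u, ?_⟩
    change e _ i = b
    exact (congrFun hc i).trans (Pi.single_eq_same ..)
  exact annih_coradical_le_ker p hp ha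

end Duality

theorem Submodule.exists_pow_eq_bot_of_le_jacobson {k A : Type*} [Field k] [Ring A] [Algebra k A]
    [IsArtinianRing A] {J : Submodule k A} (hJ : ∀ a ∈ J, a ∈ Ring.jacobson A) :
    ∃ N, J ^ N = ⊥ := by
  obtain ⟨N, hN⟩ := IsSemiprimaryRing.isNilpotent (R := A)
  refine ⟨N, ?_⟩
  have h (n : ℕ) : ∀ a ∈ J ^ n, a ∈ Ring.jacobson A ^ n := by
    induction n with
    | zero => intro a _; rw [Submodule.pow_zero, Ideal.one_eq_top]; trivial
    | succ n ih =>
      intro a ha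
      rw [Submodule.pow_succ] at ha ⊢
      induction ha using Submodule.mul_induction_on' with
      | mem_mul_mem a ha b hb => exact Submodule.mul_mem_mul (ih a ha) (hJ b hb)
      | add a _ b _ ha hb => exact add_mem ha hb
  rw [Submodule.eq_bot_iff]
  intro a ha
  have := h N a ha
  rwa [hN] at this

section GroupLike

open Coalgebra

variable {k C : Type*} [Field k] [AddCommGroup C] [Module k C] [Coalgebra k C]

theorem IsGroupLikeElem.isSimpleSubcoalgebra_span {g : C} (hg : IsGroupLikeElem k g) :
    IsSimpleSubcoalgebra k (Submodule.span k {g}) where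
  isSubcoalgebra x hx := by
    obtain ⟨c, rfl⟩ := Submodule.mem_span_singleton.1 hx
    refine ⟨c • (⟨g, Submodule.mem_span_singleton_self g⟩ ⊗ₜ
      ⟨g, Submodule.mem_span_singleton_self g⟩), ?_⟩
    rw [map_smul, map_smul, hg.comul_eq_tmul_self]
    rfl
  ne_bot h := hg.ne_zero (by simpa using h)
  eq_bot_or_eq E _ hle := by
    refine or_iff_not_imp_left.2 fun hne => le_antisymm hle ?_
    obtain ⟨x, hx, hx0⟩ := Submodule.exists_mem_ne_zero_of_ne_bot hne
    obtain ⟨c, rfl⟩ := Submodule.mem_span_singleton.1 (hle hx)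
    rw [Submodule.span_singleton_le_iff_mem]
    exact (Submodule.smul_mem_iff _ (fun h => hx0 (by simp [h]))).1 hx

theorem groupLikeSpan_le_coradical : groupLikeSpan k C ≤ coradical k C := by
  refine Submodule.span_le.2 fun g hg => ?_
  have h1 : Submodule.span k {g} ≤ coradical k C :=
    le_sSup (IsGroupLikeElem.isSimpleSubcoalgebra_span hg)
  exact h1 (Submodule.mem_span_singleton_self g)

end GroupLike

/-- A basis of the coradical of a coalgebra consisting of comatrix elements. -/
structure IsComatrixBasis (k : Type*) {H C : Type*} [Field k] [AddCommGroup H] [Module k H]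
    [Coalgebra k H] (d : C → ℕ) (X : ∀ c, Fin (d c) → Fin (d c) → H) : Prop where
  comul_apply : ∀ c r s, Coalgebra.comul (R := k) (X c r s) = ∑ u, X c r u ⊗ₜ[k] X c u s
  counit_apply : ∀ c r s, Coalgebra.counit (R := k) (X c r s) = if r = s then 1 else 0
  linearIndependent :
    LinearIndependent k fun p : (c : C) × (Fin (d c) × Fin (d c)) => X p.1 p.2.1 p.2.2
  span_eq : Submodule.span k
    (Set.range fun p : (c : C) × (Fin (d c) × Fin (d c)) => X p.1 p.2.1 p.2.2) = coradical k H

/-! ### The dual algebra of H: skew-primitives, integrals and the bounds on H₁ -/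

namespace IsComatrixBasis

open Coalgebra WithConv LinearMap SplitQuotient

section

variable {k H C : Type*} [Field k] [AddCommGroup H] [Module k H] [Coalgebra k H] {d : C → ℕ}
  {X : ∀ c, Fin (d c) → Fin (d c) → H}

/-- The algebra map from the dual algebra to a product of matrix algebras given by evaluation at
the comatrix elements. -/
noncomputable def evalHom (hX : IsComatrixBasis k d X) :
    WithConv (H →ₗ[k] k) →ₐ[k] ∀ c, Matrix (Fin (d c)) (Fin (d c)) k :=
  AlgHom.ofLinearMap
    { toFun := fun a c => Matrix.of fun r s => a (X c r s)
      map_add' := fun a b => rfl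
      map_smul' := fun m a => rfl }
    (by
      ext c r s
      change (1 : WithConv (H →ₗ[k] k)) (X c r s) = _
      rw [LinearMap.convOne_apply, hX.counit_apply]
      simp [Matrix.one_apply])
    (by
      intro a b
      ext c r s
      change (a * b) (X c r s) = _
      rw [LinearMap.convMul_apply, hX.comul_apply]
      simp only [map_sum, TensorProduct.map_tmul, LinearMap.mul'_apply]
      rfl)

theorem evalHom_apply (hX : IsComatrixBasis k d X) (a : WithConv (H →ₗ[k] k)) (c : C)
    (r s : Fin (d c)) :
    hX.evalHom a c r s = a (X c r s) := rfl

theorem evalHom_surjective (hX : IsComatrixBasis k d X) : Function.Surjective hX.evalHom := by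
  intro b
  obtain ⟨P, hP⟩ := (Finsupp.linearCombination k
    fun p : (c : C) × (Fin (d c) × Fin (d c)) => X p.1 p.2.1 p.2.2).exists_leftInverse_of_injective
      (LinearMap.ker_eq_bot.2 hX.linearIndependent)
  refine ⟨toConv (Finsupp.linearCombination k
    (fun p : (c : C) × (Fin (d c) × Fin (d c)) => b p.1 p.2.1 p.2.2) ∘ₗ P), ?_⟩
  ext c r s
  rw [evalHom_apply]
  have h1 := LinearMap.congr_fun hP (Finsupp.single ⟨c, r, s⟩ 1)
  simp only [LinearMap.comp_apply, Finsupp.linearCombination_single, one_smul,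
    LinearMap.id_apply] at h1
  simp [h1]

theorem mem_rad_evalHom (hX : IsComatrixBasis k d X) {a : WithConv (H →ₗ[k] k)} :
    a ∈ rad hX.evalHom ↔ a ∈ annih (coradical k H) := by
  rw [mem_rad, mem_annih, ← hX.span_eq]
  constructor
  · intro h x hx
    have h1 : Submodule.span k (Set.range fun p : (c : C) × (Fin (d c) × Fin (d c)) =>
        X p.1 p.2.1 p.2.2) ≤ LinearMap.ker a.ofConv := by
      rw [Submodule.span_le]
      rintro _ ⟨⟨c, r, s⟩, rfl⟩
      have := congrFun (congrFun (congrFun h c) r) s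
      rwa [evalHom_apply] at this
    exact h1 hx
  · intro h
    ext c r s
    rw [evalHom_apply]
    exact h _ (Submodule.subset_span ⟨⟨c, r, s⟩, rfl⟩)

theorem rad_evalHom (hX : IsComatrixBasis k d X) : rad hX.evalHom = annih (coradical k H) :=
  Submodule.ext fun _ => hX.mem_rad_evalHom

theorem isGroupLikeElem (hX : IsComatrixBasis k d X) {c : C} (hc : d c = 1) (r : Fin (d c)) :
    IsGroupLikeElem k (X c r r) where
  counit_eq_one := by simp [hX.counit_apply]
  comul_eq_tmul_self := by
    have : Subsingleton (Fin (d c)) := by rw [hc]; infer_instance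
    rw [hX.comul_apply, Fintype.sum_subsingleton _ r]

theorem coradicalFiltration_one_eq (hX : IsComatrixBasis k d X) [Module.Finite k H] :
    coradicalFiltration k H 1 = coannih (radSq hX.evalHom) := by
  rw [_root_.coradicalFiltration_one_eq, radSq, rad_evalHom]

theorem exists_rad_pow_eq_bot (hX : IsComatrixBasis k d X) [IsAlgClosed k] [Module.Finite k H] :
    ∃ N, rad hX.evalHom ^ N = ⊥ := by
  have := IsArtinianRing.of_finite k (WithConv (H →ₗ[k] k))
  exact Submodule.exists_pow_eq_bot_of_le_jacobson fun a ha =>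
    annih_coradical_le_jacobson (hX.mem_rad_evalHom.1 ha)

/-- Without nontrivial skew-primitives, no Peirce component between two one-dimensional blocks
survives modulo the square of the radical. -/
theorem mul_mul_mem_radSq (hX : IsComatrixBasis k d X) [Module.Finite k H] [DecidableEq C]
    (hskew : NoNontrivialSkewPrimitives k H) {c c' : C} (hc : d c = 1) (hc' : d c' = 1)
    (r : Fin (d c)) (r' : Fin (d c')) {x : WithConv (H →ₗ[k] k)} (hx : x ∈ rad hX.evalHom) :
    liftUnit hX.evalHom_surjective c r r * x * liftUnit hX.evalHom_surjective c' r' r' ∈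
      radSq hX.evalHom := by
  by_contra h
  obtain ⟨F, hF, hder⟩ := exists_derivation hX.evalHom_surjective hc hc' r r' hx h
  -- By finite-dimensionality the derivation is evaluation at some y in H, and the derivation rule
  -- says that y is skew-primitive. Then y is in the coradical, where x vanishes.
  obtain ⟨y, hy⟩ := (Module.evalEquiv k H).surjective
    (F ∘ₗ (WithConv.linearEquiv k (H →ₗ[k] k)).symm.toLinearMap)
  have hy' (a : WithConv (H →ₗ[k] k)) : F a = a y := (LinearMap.congr_fun hy a.ofConv).symm
  have hsp : IsSkewPrimitive k y := by
    refine ⟨X c' r' r', X c r r, hX.isGroupLikeElem hc' r', hX.isGroupLikeElem hc r, ?_⟩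
    rw [← sub_eq_zero]
    apply TensorProduct.eq_zero_of_forall_dual
    intro f g
    have h1 := hder (toConv f) (toConv g)
    rw [hy', hy', hy', convMul_apply] at h1
    rw [map_sub, map_sub, sub_eq_zero]
    refine h1.trans ?_
    simp [evalHom_apply]
  apply hF
  rw [hy']
  exact mem_annih.1 (hX.mem_rad_evalHom.1 hx) y (groupLikeSpan_le_coradical (hskew y hsp))

end

section Hopf

variable {k H C : Type*} [Field k] [Ring H] [HopfAlgebra k H]

/-- Since Δ(gx) = (g ⊗ g)Δ(x), translation by g is multiplicative on the dual; it moves the block of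
g to that of 1. -/
theorem conv_comp_mulLeft {g : H} (hg : IsGroupLikeElem k g) (a b : WithConv (H →ₗ[k] k)) :
    toConv (a.ofConv ∘ₗ mulLeft k g) * toConv (b.ofConv ∘ₗ mulLeft k g) =
      toConv ((a * b).ofConv ∘ₗ mulLeft k g) := by
  ext x
  change mul' k k
      (TensorProduct.map (a.ofConv ∘ₗ mulLeft k g) (b.ofConv ∘ₗ mulLeft k g) (comul x)) =
    mul' k k (TensorProduct.map a.ofConv b.ofConv (comul (R := k) (g * x)))
  rw [Bialgebra.comul_mul, hg.comul_eq_tmul_self]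
  generalize comul (R := k) x = w
  induction w with
  | zero => simp
  | add u v hu hv => simp only [map_add, mul_add, hu, hv]
  | tmul p q => simp

variable [Module.Finite k H] {d : C → ℕ} {X : ∀ c, Fin (d c) → Fin (d c) → H}

theorem apply_one_eq_zero_of_mul_eq (hX : IsComatrixBasis k d X) [IsAlgClosed k]
    (hcoss : ¬ IsCosemisimple k H)
    {t : WithConv (H →ₗ[k] k)} (ht : ∀ a : WithConv (H →ₗ[k] k), a * t = a 1 • t) : t 1 = 0 := by
  by_contra h
  apply hcoss
  obtain ⟨N, hN⟩ := hX.exists_rad_pow_eq_bot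
  refine IsLeftIntegral.eq_top (t := ((t 1)⁻¹ • t).ofConv) ?_ ?_ (D := coradical k H) ?_ ?_
  · rw [isLeftIntegral_iff]
    intro a
    rw [mul_smul_comm, ht, smul_comm]
  · change (t 1)⁻¹ * t 1 = 1
    exact inv_mul_cancel₀ h
  · intro a j hj
    rw [← hX.mem_rad_evalHom] at *
    exact mul_mem_rad_left a hj
  · intro j hj
    rw [← hX.mem_rad_evalHom] at hj
    refine ⟨N, ?_⟩
    have := Submodule.pow_mem_pow _ hj N
    rwa [hN, Submodule.mem_bot] at this

/-- For a nonzero left integral t, the product e * t equals both e(1) t and t(1) e = 0. -/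
theorem apply_one_eq_zero_of_mul_eq' (hX : IsComatrixBasis k d X) [IsAlgClosed k]
    (hcoss : ¬ IsCosemisimple k H)
    {e : WithConv (H →ₗ[k] k)} (he : ∀ a : WithConv (H →ₗ[k] k), e * a = a 1 • e) : e 1 = 0 := by
  have : Nontrivial H := by
    by_contra h
    rw [not_nontrivial_iff_subsingleton] at h
    exact hcoss (Subsingleton.elim _ _)
  obtain ⟨t, ht0, ht⟩ := exists_isLeftIntegral k H
  have ht' := isLeftIntegral_iff (t := toConv t).1 ht
  have h0 := hX.apply_one_eq_zero_of_mul_eq hcoss ht'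
  have h1 := ht' e
  rw [he, h0, zero_smul] at h1
  rcases smul_eq_zero.1 h1.symm with h | h
  · exact h
  · exact absurd (toConv_eq_zero.1 h) ht0

/-- Otherwise some e satisfies a * e = a(g) e and e(g) = 1, and its translate by the grouplike g is
a left integral with value 1 at 1. -/
theorem exists_mul_liftUnit_notMem (hX : IsComatrixBasis k d X) [IsAlgClosed k] [DecidableEq C]
    (hcoss : ¬ IsCosemisimple k H)
    {c : C} (hc : d c = 1) (r : Fin (d c)) :
    ∃ x ∈ rad hX.evalHom, x * liftUnit hX.evalHom_surjective c r r ∉ radSq hX.evalHom := by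
  by_contra! h
  obtain ⟨N, hN⟩ := hX.exists_rad_pow_eq_bot
  obtain ⟨e, he1, he⟩ := exists_mul_eq_smul hX.evalHom_surjective hN hc r h
  have hg := hX.isGroupLikeElem hc r
  have h0 := hX.apply_one_eq_zero_of_mul_eq hcoss
    (t := toConv (e.ofConv ∘ₗ mulLeft k (X c r r))) (fun a => by
      have h1 := conv_comp_mulLeft hg
        (toConv (a.ofConv ∘ₗ mulLeft k (HopfAlgebra.antipode k (X c r r)))) e
      have h2 : (a.ofConv ∘ₗ mulLeft k (HopfAlgebra.antipode k (X c r r))) ∘ₗ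
          mulLeft k (X c r r) = a.ofConv := by
        ext x
        simp [← mul_assoc, hg.antipode_mul_cancel]
      rw [he, evalHom_apply, ofConv_toConv, h2] at h1
      simpa [hg.antipode_mul_cancel, LinearMap.smul_comp] using h1)
  rw [evalHom_apply] at he1
  simp [he1] at h0

theorem exists_liftUnit_mul_notMem (hX : IsComatrixBasis k d X) [IsAlgClosed k] [DecidableEq C]
    (hcoss : ¬ IsCosemisimple k H)
    {c : C} (hc : d c = 1) (r : Fin (d c)) :
    ∃ x ∈ rad hX.evalHom, liftUnit hX.evalHom_surjective c r r * x ∉ radSq hX.evalHom := by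
  by_contra! h
  obtain ⟨N, hN⟩ := hX.exists_rad_pow_eq_bot
  obtain ⟨e, he1, he⟩ := exists_mul_eq_smul' hX.evalHom_surjective hN hc r h
  have hg := hX.isGroupLikeElem hc r
  have h0 := hX.apply_one_eq_zero_of_mul_eq' hcoss
    (e := toConv (e.ofConv ∘ₗ mulLeft k (X c r r))) (fun a => by
      have h1 := conv_comp_mulLeft hg e
        (toConv (a.ofConv ∘ₗ mulLeft k (HopfAlgebra.antipode k (X c r r))))
      have h2 : (a.ofConv ∘ₗ mulLeft k (HopfAlgebra.antipode k (X c r r))) ∘ₗ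
          mulLeft k (X c r r) = a.ofConv := by
        ext x
        simp [← mul_assoc, hg.antipode_mul_cancel]
      rw [he, evalHom_apply, ofConv_toConv, h2] at h1
      simpa [hg.antipode_mul_cancel, LinearMap.smul_comp] using h1)
  rw [evalHom_apply] at he1
  simp [he1] at h0

/-- The second power of the radical of the dual algebra is nonzero. -/
theorem radSq_ne_bot (hX : IsComatrixBasis k d X) [IsAlgClosed k] [Fintype C]
    (hcoss : ¬ IsCosemisimple k H)
    (hskew : NoNontrivialSkewPrimitives k H) : radSq hX.evalHom ≠ ⊥ := by
  classical
  have : Nontrivial H := by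
    by_contra h
    rw [not_nontrivial_iff_subsingleton] at h
    exact hcoss (Subsingleton.elim _ _)
  obtain ⟨N, hN⟩ := hX.exists_rad_pow_eq_bot
  obtain ⟨t, ht0, htI⟩ := exists_isLeftIntegral k H
  have ht0' : toConv t ≠ 0 := fun h => ht0 (toConv_eq_zero.1 h)
  have ht := isLeftIntegral_iff (t := toConv t).1 htI
  -- t * a is again a left integral, so uniqueness applies; the scalar is a character α of the dual
  -- algebra.
  have hright (a : WithConv (H →ₗ[k] k)) : ∃ m : k, toConv t * a = m • toConv t := by
    obtain ⟨m, hm⟩ := htI.exists_smul_eq (t' := (toConv t * a).ofConv)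
      (isLeftIntegral_iff.2 fun b => by rw [← mul_assoc, ht, smul_mul_assoc]) ht0
    exact ⟨m, WithConv.ext hm⟩
  choose m hm using hright
  have hinj := smul_left_injective k ht0'
  let α : WithConv (H →ₗ[k] k) →ₐ[k] k := AlgHom.ofLinearMap
    { toFun := m
      map_add' := fun a b => hinj (by simp only [← hm, mul_add, add_smul])
      map_smul' := fun c a => hinj (by
        simp only [← hm, mul_smul_comm, smul_eq_mul, RingHom.id_apply, mul_smul]) }
    (hinj (by
      change m 1 • toConv t = (1 : k) • toConv t
      rw [← hm, mul_one, one_smul]))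
    (fun a b => hinj (by
      change m (a * b) • toConv t = (m a * m b) • toConv t
      rw [← hm, ← mul_assoc, hm, smul_mul_assoc, hm, smul_smul]))
  let ε : WithConv (H →ₗ[k] k) →ₐ[k] k := AlgHom.ofLinearMap
    { toFun := fun a => a 1
      map_add' := fun a b => rfl
      map_smul' := fun c a => rfl }
    (by
      change (1 : WithConv (H →ₗ[k] k)) 1 = 1
      rw [LinearMap.convOne_apply, Bialgebra.counit_one, map_one])
    (fun a b => by
      change (a * b) 1 = a 1 * b 1
      rw [LinearMap.convMul_apply, Bialgebra.comul_one, Algebra.TensorProduct.one_def,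
        TensorProduct.map_tmul, LinearMap.mul'_apply])
  obtain ⟨c, r, hc, hε⟩ := exists_eq_block_of_algHom hX.evalHom_surjective hN ε
  obtain ⟨c', r', hc', hα⟩ := exists_eq_block_of_algHom hX.evalHom_surjective hN α
  have h1 : liftUnit hX.evalHom_surjective c r r * toConv t = toConv t := by
    have h2 : ε (liftUnit hX.evalHom_surjective c r r) = 1 := by
      rw [hε, map_liftUnit, matUnit_self_apply]
    rw [ht]
    change ε _ • _ = _
    rw [h2, one_smul]
  have h2 : toConv t * liftUnit hX.evalHom_surjective c' r' r' = toConv t := by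
    have h2 : α (liftUnit hX.evalHom_surjective c' r' r') = 1 := by
      rw [hα, map_liftUnit, matUnit_self_apply]
    rw [hm]
    change α _ • _ = _
    rw [h2, one_smul]
  -- As t = e_c t, its image lives only in the block of ε, where its entry is t(1) = 0.
  have h3 : toConv t ∈ rad hX.evalHom := by
    have h4 : ε (toConv t) = 0 := hX.apply_one_eq_zero_of_mul_eq hcoss ht
    rw [mem_rad, ← h1, map_mul, map_liftUnit, matUnit_mul_of_eq_one hc, ← hε, h4, zero_smul]
  have h5 := hX.mul_mul_mem_radSq hskew hc hc' r r' h3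
  rw [h1, h2] at h5
  intro h
  rw [h, Submodule.mem_bot] at h5
  exact ht0' h5

theorem finrank_coradicalFiltration_one_lt (hX : IsComatrixBasis k d X) [IsAlgClosed k] [Fintype C]
    (hcoss : ¬ IsCosemisimple k H) (hskew : NoNontrivialSkewPrimitives k H) :
    Module.finrank k (coradicalFiltration k H 1) < Module.finrank k H := by
  have h1 := finrank_add_finrank_coannih (radSq hX.evalHom)
  have h2 : 0 < Module.finrank k (radSq hX.evalHom) := by
    rw [Nat.pos_iff_ne_zero, Ne, Submodule.finrank_eq_zero]
    exact hX.radSq_ne_bot hcoss hskew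
  rw [hX.coradicalFiltration_one_eq]
  omega

theorem le_finrank_coradicalFiltration_one (hX : IsComatrixBasis k d X) [IsAlgClosed k] [Fintype C]
    (hcoss : ¬ IsCosemisimple k H) (hskew : NoNontrivialSkewPrimitives k H) {m : ℕ}
    (hm : ∀ c, d c ≠ 1 → m ≤ d c) :
    2 * m * Fintype.card {c // d c = 1} + ∑ c, d c ^ 2 ≤
      Module.finrank k (coradicalFiltration k H 1) := by
  classical
  have h1 := finrank_add_finrank_coannih (radSq hX.evalHom)
  have h2 := two_mul_card_add_finrank_radSq_le hX.evalHom_surjective hm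
    (fun c r hc => hX.exists_mul_liftUnit_notMem hcoss hc r)
    (fun c r hc => hX.exists_liftUnit_mul_notMem hcoss hc r)
    (fun c r c' r' hc hc' x hx => hX.mul_mul_mem_radSq hskew hc hc' r r' hx)
  have h3 := finrank_rad_add_sum_sq hX.evalHom_surjective
  rw [finrank_withConv_dual] at h3
  rw [hX.coradicalFiltration_one_eq]
  omega

end Hopf

end IsComatrixBasis

/-! ### The splitting of H₁ given by a coradical projection -/

section Projection

open Coalgebra LinearMap

variable {k C : Type*} [Field k] [AddCommGroup C] [Module k C] [Coalgebra k C] {π : C →ₗc[k] C}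

namespace IsCoradicalProjection

theorem apply_mem (hπ : IsCoradicalProjection π) (x : C) : π x ∈ coradical k C := by
  rw [← hπ.range_eq]; exact ⟨x, rfl⟩

theorem rTensor_mem (hπ : IsCoradicalProjection π) (w : C ⊗[k] C) :
    (π : C →ₗ[k] C).rTensor C w ∈ LinearMap.range ((coradical k C).subtype.rTensor C) := by
  have h : (π : C →ₗ[k] C) =
      (coradical k C).subtype ∘ₗ (π : C →ₗ[k] C).codRestrict (coradical k C) hπ.apply_mem := rfl
  rw [h, rTensor_comp_apply]
  exact ⟨_, rfl⟩

theorem lTensor_mem (hπ : IsCoradicalProjection π) (w : C ⊗[k] C) :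
    (π : C →ₗ[k] C).lTensor C w ∈ LinearMap.range ((coradical k C).subtype.lTensor C) := by
  have h : (π : C →ₗ[k] C) =
      (coradical k C).subtype ∘ₗ (π : C →ₗ[k] C).codRestrict (coradical k C) hπ.apply_mem := rfl
  rw [h, lTensor_comp_apply]
  exact ⟨_, rfl⟩

theorem comp_self (hπ : IsCoradicalProjection π) :
    (π : C →ₗ[k] C) ∘ₗ (π : C →ₗ[k] C) = (π : C →ₗ[k] C) := by
  ext x
  exact hπ.apply_of_mem _ (hπ.apply_mem x)

theorem comul_apply (x : C) :
    comul (R := k) (π x) = TensorProduct.map (π : C →ₗ[k] C) (π : C →ₗ[k] C) (comul x) :=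
  (CoalgHomClass.map_comp_comul_apply π x).symm

theorem rhoL_apply_of_mem (hπ : IsCoradicalProjection π) {x : C} (hx : x ∈ coradical k C) :
    rhoL π x = comul (R := k) x := by
  rw [rhoL, LinearMap.comp_apply]
  conv_lhs => rw [← hπ.apply_of_mem x hx]
  conv_rhs => rw [← hπ.apply_of_mem x hx]
  rw [comul_apply, ← LinearMap.comp_apply, rTensor_comp_map, hπ.comp_self]

theorem rhoR_apply_of_mem (hπ : IsCoradicalProjection π) {x : C} (hx : x ∈ coradical k C) :
    rhoR π x = comul (R := k) x := by
  rw [rhoR, LinearMap.comp_apply]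
  conv_lhs => rw [← hπ.apply_of_mem x hx]
  conv_rhs => rw [← hπ.apply_of_mem x hx]
  rw [comul_apply, ← LinearMap.comp_apply, lTensor_comp_map, hπ.comp_self]

theorem mem_coradicalFiltration_one {x : C} : x ∈ coradicalFiltration k C 1 ↔
    comul (R := k) x ∈ LinearMap.range ((coradical k C).subtype.rTensor C) ⊔
      LinearMap.range ((coradical k C).subtype.lTensor C) :=
  Iff.rfl

theorem coradical_le (hπ : IsCoradicalProjection π) :
    coradical k C ≤ coradicalFiltration k C 1 := by
  intro x hx
  rw [mem_coradicalFiltration_one, ← hπ.rhoL_apply_of_mem hx]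
  exact Submodule.mem_sup_left (hπ.rTensor_mem _)

theorem mem_subspaceP1 {x : C} : x ∈ subspaceP1 π ↔ comul (R := k) x = rhoL π x + rhoR π x :=
  Iff.rfl

theorem subspaceP1_le (hπ : IsCoradicalProjection π) :
    subspaceP1 π ≤ coradicalFiltration k C 1 := by
  intro x hx
  rw [mem_coradicalFiltration_one, mem_subspaceP1.1 hx]
  exact add_mem (Submodule.mem_sup_left (hπ.rTensor_mem _))
    (Submodule.mem_sup_right (hπ.lTensor_mem _))

/-- On the coradical both coactions equal Δ, so membership in P₁ reads Δ(x) = 2Δ(x); then Δ(x) = 0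
and x = 0. -/
theorem disjoint (hπ : IsCoradicalProjection π) :
    Disjoint (coradical k C) (subspaceP1 π) := by
  rw [Submodule.disjoint_def]
  intro x hx hx1
  rw [mem_subspaceP1, hπ.rhoL_apply_of_mem hx, hπ.rhoR_apply_of_mem hx, left_eq_add] at hx1
  have h := rTensor_counit_comul (R := k) x
  rw [hx1, map_zero] at h
  have h2 := congrArg (TensorProduct.lid k C) h
  simpa using h2.symm

/-- q = id − π kills the coradical, so (q ⊗ q)Δ(x) = 0 on C₁. Expanding, Δ(x) + Δ(π x) = ρ_L(x) +
ρ_R(x). -/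
theorem sub_apply_mem (hπ : IsCoradicalProjection π) {x : C}
    (hx : x ∈ coradicalFiltration k C 1) : x - π x ∈ subspaceP1 π := by
  have hx' := mem_coradicalFiltration_one.1 hx
  let p : C →ₗ[k] C := (π : C →ₗ[k] C)
  have hp (y : C) : π y = p y := rfl
  let q : C →ₗ[k] C := LinearMap.id - p
  have hq : q ∘ₗ (coradical k C).subtype = 0 := by
    ext y
    simp [q, p, hπ.apply_of_mem y y.2]
  have h0 : TensorProduct.map q q (comul (R := k) x) = 0 := by
    obtain ⟨_, ⟨u, rfl⟩, _, ⟨v, rfl⟩, h⟩ := Submodule.mem_sup.1 hx'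
    rw [← h, map_add, ← LinearMap.comp_apply, ← LinearMap.comp_apply, map_comp_rTensor,
      map_comp_lTensor, hq]
    simp
  have h1 (w : C ⊗[k] C) : TensorProduct.map q q w =
      w + TensorProduct.map p p w - (p.rTensor C w + p.lTensor C w) := by
    induction w with
    | zero => simp
    | add u v hu hv => simp only [map_add, hu, hv]; abel
    | tmul a b =>
      simp only [q, TensorProduct.map_tmul, LinearMap.sub_apply, LinearMap.id_apply,
        TensorProduct.sub_tmul, TensorProduct.tmul_sub, rTensor_tmul, lTensor_tmul]
      abel
  rw [h1, sub_eq_zero] at h0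
  rw [mem_subspaceP1, map_sub, map_sub, map_sub, hπ.rhoL_apply_of_mem (hπ.apply_mem x),
    hπ.rhoR_apply_of_mem (hπ.apply_mem x), comul_apply]
  change comul (R := k) x - TensorProduct.map p p (comul (R := k) x) =
    p.rTensor C (comul x) - TensorProduct.map p p (comul (R := k) x) +
      (p.lTensor C (comul x) - TensorProduct.map p p (comul (R := k) x))
  rw [sub_add_sub_comm, ← h0]
  abel

/-- For a coalgebra projection `π` onto the coradical, `C₁ = C₀ ⊕ P₁(π)`. -/
theorem finrank_coradicalFiltration_one [Module.Finite k C] (hπ : IsCoradicalProjection π) :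
    Module.finrank k (coradicalFiltration k C 1) =
      Module.finrank k (coradical k C) + Module.finrank k (subspaceP1 π) := by
  have h1 : coradical k C ⊔ subspaceP1 π = coradicalFiltration k C 1 := by
    refine le_antisymm (sup_le hπ.coradical_le hπ.subspaceP1_le) fun x hx => ?_
    rw [← add_sub_cancel (π x) x]
    exact Submodule.add_mem_sup (hπ.apply_mem x) (hπ.sub_apply_mem hx)
  rw [← h1, ← Submodule.finrank_sup_add_finrank_inf_eq, hπ.disjoint.eq_bot, finrank_bot, add_zero]

end IsCoradicalProjection

end Projection

/-! ### Comatrix elements of the given decomposition, and the theorem -/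

section Decomposition

open Coalgebra

variable {k : Type*} [Field k] {G : Type*} {t : ℕ} (n : Fin t → ℕ)

/-- The sizes of the blocks of `k[G] ⊕ M^c(n₁, k) ⊕ ⋯ ⊕ M^c(nₜ, k)`. -/
def blockSize : G ⊕ Fin t → ℕ := Sum.elim (fun _ => 1) n

variable (k G) in
/-- The comatrix elements of `k[G] ⊕ M^c(n₁, k) ⊕ ⋯ ⊕ M^c(nₜ, k)`. -/
noncomputable def blockBasis : ∀ c : G ⊕ Fin t, Fin (blockSize n c) → Fin (blockSize n c) →
    MonoidAlgebra k G × (∀ i : Fin t, MatrixCoalgebra (n i) k)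
  | .inl g, _, _ => (MonoidAlgebra.single g 1, 0)
  | .inr i, r, s => (0, Pi.single i (MatrixCoalgebra.basis (n i) k (r, s)))

theorem comul_blockBasis (c : G ⊕ Fin t) (r s : Fin (blockSize n c)) :
    comul (R := k) (blockBasis k G n c r s) =
      ∑ u, blockBasis k G n c r u ⊗ₜ[k] blockBasis k G n c u s := by
  rcases c with g | i
  · have : Subsingleton (Fin (blockSize n (.inl g : G ⊕ Fin t))) :=
      inferInstanceAs (Subsingleton (Fin 1))
    rw [Fintype.sum_subsingleton _ r]
    simp [blockBasis, Prod.comul_apply]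
  · simp only [blockBasis, Prod.comul_apply, map_zero, zero_add, Pi.comul_single]
    erw [MatrixCoalgebra.comul_basis]
    simp only [map_sum, TensorProduct.map_tmul]
    rfl

theorem counit_blockBasis (c : G ⊕ Fin t) (r s : Fin (blockSize n c)) :
    counit (R := k) (blockBasis k G n c r s) = if r = s then 1 else 0 := by
  rcases c with g | i
  · have : Subsingleton (Fin (blockSize n (.inl g : G ⊕ Fin t))) :=
      inferInstanceAs (Subsingleton (Fin 1))
    rw [if_pos (Subsingleton.elim _ _)]
    simp [blockBasis, Prod.counit_apply]
  · simp only [blockBasis, Prod.counit_apply, map_zero, zero_add, Pi.counit_single]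
    exact MatrixCoalgebra.counit_basis (n i) k r s

/-- The index of a comatrix element in the sum decomposition. -/
def blockIndex : ((c : G ⊕ Fin t) × (Fin (blockSize n c) × Fin (blockSize n c))) →
    G ⊕ ((i : Fin t) × (Fin (n i) × Fin (n i)))
  | ⟨.inl g, _⟩ => .inl g
  | ⟨.inr i, p⟩ => .inr ⟨i, p⟩

theorem blockIndex_bijective : Function.Bijective (blockIndex (G := G) n) := by
  constructor
  · rintro ⟨g | i, p⟩ ⟨g' | i', p'⟩ h
    · obtain rfl := Sum.inl_injective h
      have : Subsingleton (Fin (blockSize n (.inl g : G ⊕ Fin t))) :=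
        inferInstanceAs (Subsingleton (Fin 1))
      rw [Subsingleton.elim p p']
    · exact absurd h Sum.inl_ne_inr
    · exact absurd h Sum.inr_ne_inl
    · obtain ⟨rfl, h2⟩ := Sigma.mk.inj_iff.1 (Sum.inr_injective h)
      rw [eq_of_heq h2]
  · rintro (g | ⟨i, p⟩)
    · exact ⟨⟨.inl g, (0 : Fin 1), (0 : Fin 1)⟩, rfl⟩
    · exact ⟨⟨.inr i, p⟩, rfl⟩

variable (k G) in
/-- The basis of comatrix elements of `k[G] ⊕ M^c(n₁, k) ⊕ ⋯ ⊕ M^c(nₜ, k)`. -/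
noncomputable def sumBasis : Module.Basis (G ⊕ ((i : Fin t) × (Fin (n i) × Fin (n i)))) k
    (MonoidAlgebra k G × (∀ i : Fin t, MatrixCoalgebra (n i) k)) :=
  (Module.Basis.ofRepr (MonoidAlgebra.coeffLinearEquiv k)).prod
    (Pi.basis fun i => MatrixCoalgebra.basis (n i) k)

theorem sumBasis_blockIndex (p : (c : G ⊕ Fin t) × (Fin (blockSize n c) × Fin (blockSize n c))) :
    sumBasis k G n (blockIndex n p) = blockBasis k G n p.1 p.2.1 p.2.2 := by
  obtain ⟨g | i, r, s⟩ := p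
  · simp only [blockIndex, sumBasis, blockBasis]
    ext1
    · simp
    · simp
  · simp only [blockIndex, sumBasis, blockBasis]
    ext1
    · simp
    · simp [Pi.basis_apply]
      rfl

/-- An isomorphism of the coradical with `k[G] ⊕ M^c(n₁, k) ⊕ ⋯ ⊕ M^c(nₜ, k)` provides a basis of
comatrix elements. -/
theorem isComatrixBasis_blockBasis {H : Type*} [AddCommGroup H] [Module k H] [Coalgebra k H]
    (φ : (MonoidAlgebra k G × (∀ i : Fin t, MatrixCoalgebra (n i) k)) →ₗc[k] H)
    (hφ : Function.Injective φ) (hH₀ : LinearMap.range φ.toLinearMap = coradical k H) :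
    IsComatrixBasis k (blockSize (G := G) n) fun c r s => φ (blockBasis k G n c r s) where
  comul_apply c r s := by
    rw [← CoalgHomClass.map_comp_comul_apply, comul_blockBasis, map_sum]
    rfl
  counit_apply c r s := by
    rw [CoalgHomClass.counit_comp_apply, counit_blockBasis]
  linearIndependent := by
    simp_rw [← sumBasis_blockIndex]
    exact ((sumBasis k G n).linearIndependent.map' φ.toLinearMap
      (LinearMap.ker_eq_bot.2 hφ)).comp _ (blockIndex_bijective n).1
  span_eq := by
    simp_rw [← sumBasis_blockIndex]
    rw [← hH₀, LinearMap.range_eq_map, ← (sumBasis k G n).span_eq, Submodule.map_span,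
      ← Set.range_comp, ← (blockIndex_bijective n).2.range_comp]
    rfl

end Decomposition

theorem mainTheorem4 {k : Type*} [Field k] [IsAlgClosed k] [CharZero k]
    {H : Type*} [Ring H] [HopfAlgebra k H] [Module.Finite k H]
    (hcoss : ¬ IsCosemisimple k H) (hskew : NoNontrivialSkewPrimitives k H)
    {G : Type*} [Group G] (t : ℕ) (ht : 0 < t) (n : Fin t → ℕ)
    (hmono : Monotone n) (hn : ∀ i, 2 ≤ n i)
    (φ : (MonoidAlgebra k G × (∀ i : Fin t, MatrixCoalgebra (n i) k)) →ₗc[k] H)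
    (hφ : Function.Injective φ)
    (hH₀ : LinearMap.range φ.toLinearMap = coradical k H) :
    Module.finrank k (coradicalFiltration k H 1) < Module.finrank k H ∧
    (∀ π : H →ₗc[k] H, IsCoradicalProjection π →
      Module.finrank k (coradicalFiltration k H 1) =
        Module.finrank k (coradical k H) + Module.finrank k (subspaceP1 π)) ∧
    (1 + 2 * n ⟨0, ht⟩) * Nat.card G + ∑ i, n i ^ 2 ≤
      Module.finrank k (coradicalFiltration k H 1) := by
  have hX := isComatrixBasis_blockBasis n φ hφ hH₀
  have : Finite G := by
    have h1 := ((sumBasis k G n).linearIndependent.map' φ.toLinearMap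
      (LinearMap.ker_eq_bot.2 hφ)).comp Sum.inl Sum.inl_injective
    exact h1.finite
  have := Fintype.ofFinite G
  refine ⟨hX.finrank_coradicalFiltration_one_lt hcoss hskew,
    fun π hπ => hπ.finrank_coradicalFiltration_one, ?_⟩
  have hcard : Fintype.card {c : G ⊕ Fin t // blockSize n c = 1} = Nat.card G := by
    rw [Nat.card_eq_fintype_card]
    refine Fintype.card_congr (Equiv.ofBijective
      (fun g : G => (⟨.inl g, rfl⟩ : {c : G ⊕ Fin t // blockSize n c = 1})) ⟨?_, ?_⟩).symm
    · intro g g' h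
      exact Sum.inl_injective (congrArg Subtype.val h)
    · rintro ⟨g | i, h⟩
      · exact ⟨g, rfl⟩
      · have : n i = 1 := h
        have := hn i
        omega
  have h1 := hX.le_finrank_coradicalFiltration_one hcoss hskew (m := n ⟨0, ht⟩) (by
    rintro (g | i) hc
    · exact absurd rfl hc
    · exact hmono (Fin.mk_le_of_le_val (Nat.zero_le _)))
  rw [hcard, Fintype.sum_sum_type] at h1
  -- The grouplike blocks contribute |G| to the sum of squares, which is the 1 in 1 + 2n₁.
  have h2 : ∑ g : G, blockSize n (.inl g : G ⊕ Fin t) ^ 2 = Nat.card G := by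
    simp [blockSize]
  have h3 : ∑ i, blockSize n (.inr i : G ⊕ Fin t) ^ 2 = ∑ i, n i ^ 2 := rfl
  rw [h2, h3] at h1
  linarith
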